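/- Let $m,n\ge 2$ be integers and let $\mathbb F_{\mathrm{id}}^+$ be the unital semigroup (rank 2 graph on a single vertex) generated by $e_1,\dots,e_m,f_1,\dots,f_n$ subject only to the relations $e_if_j=f_je_i$ for all $i,j$. A word $w$ with $k$ letters $e$ and $l$ letters $f$ has degree $d(w)=(k,l)$. Let $\mathcal O_{\mathrm{id}}$ be its graph C*-algebra, that is, the universal unital C*-algebra generated by isometries $\{s_u:u\in\mathbb F_{\mathrm{id}}^+\}$ with $s_\varnothing=1$, $s_{uv}=s_us_v$ and $$\sum_{i=1}^m s_{e_i}s_{e_i}^*=1=\sum_{j=1}^n s_{f_j}s_{f_j}^*.$$ For $\mathbf t=(t_1,t_2)\in\mathbb T^2$ let $\gamma_{\mathbf t}$ be the gauge automorphism of $\mathcal O_{\mathrm{id}}$ with $\gamma_{\mathbf t}(s_w)=t_1^kt_2^l s_w$ when $d(w)=(k,l)$, let $\mathfrak F$ be the fixed point algebra of $\gamma$, and let $\Phi(X)=\int_{\mathbb T^2}\gamma_{\mathbf t}(X)\,d\mathbf t$ (normalized Haar measure) be the expectation of $\mathcal O_{\mathrm{id}}$ onto $\mathfrak F$. Let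 $\sigma=\{\sigma_t\}_{t\in\mathbb R}$ be the one-parameter automorphism group of $\mathcal O_{\mathrm{id}}$ given by $$\sigma_t(s_us_v^*)=m^{it(k'-k)}\,n^{it(l'-l)}\,s_us_v^*\qquad\text{when } d(u)=(k,l),\ d(v)=(k',l').$$ A $\sigma$-KMS state is a state $\varphi$ of $\mathcal O_{\mathrm{id}}$ with $\varphi(AB)=\varphi(B\,\sigma_{-i}(A))$ for all $A,B$ entire for $\sigma$ (that is, $t\mapsto\sigma_t(A)$ extends to an entire function $z\mapsto\sigma_z(A)$ on $\mathbb C$, and likewise for $B$). Then $\mathfrak F$ has a unique tracial state $\tau$, and the distinguished state $\omega:=\tau\circ\Phi$ is a $\sigma$-KMS state and is the only $\sigma$-KMS state on $\mathcal O_{\mathrm{id}}$. (No assumption is made on $\ln m/\ln n$; it may be rational.) -/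

import Mathlib

namespace RankTwoGraph

open scoped ENNReal ComplexOrder

/-- The commutation relations `e_i f_j = f_{j'} e_{i'}` where `θ (i, j) = (i', j')`; the letter
`e_i` is `Sum.inl i` and the letter `f_j` is `Sum.inr j`. -/
inductive CommRel {m n : ℕ} (θ : Equiv.Perm (Fin m × Fin n)) :
    FreeMonoid (Fin m ⊕ Fin n) → FreeMonoid (Fin m ⊕ Fin n) → Prop
  | comm (i : Fin m) (j : Fin n) : CommRel θ
      (FreeMonoid.of (Sum.inl i) * FreeMonoid.of (Sum.inr j))
      (FreeMonoid.of (Sum.inr (θ (i, j)).2) * FreeMonoid.of (Sum.inl (θ (i, j)).1))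

/-- The rank 2 graph on a single vertex `𝔽_θ⁺`, a unital semigroup. -/
abbrev Graph {m n : ℕ} (θ : Equiv.Perm (Fin m × Fin n)) : Type := PresentedMonoid (CommRel θ)

/-- The generator `e_i`. -/
def e {m n : ℕ} (θ : Equiv.Perm (Fin m × Fin n)) (i : Fin m) : Graph θ :=
  PresentedMonoid.of (CommRel θ) (Sum.inl i)

/-- The generator `f_j`. -/
def f {m n : ℕ} (θ : Equiv.Perm (Fin m × Fin n)) (j : Fin n) : Graph θ :=
  PresentedMonoid.of (CommRel θ) (Sum.inr j)

/-- The degree of a word: `(1, 0)` on each `e_i` and `(0, 1)` on each `f_j`. -/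
def degree {m n : ℕ} (θ : Equiv.Perm (Fin m × Fin n)) : Graph θ →* Multiplicative (ℕ × ℕ) :=
  PresentedMonoid.lift
    (Sum.elim (fun _ => Multiplicative.ofAdd (1, 0)) (fun _ => Multiplicative.ofAdd (0, 1)))
    (by rintro _ _ ⟨i, j⟩; simp [mul_comm])

/-- A family of isometries `{s_u : u ∈ 𝔽_θ⁺}` in a unital C*-algebra with `s_∅ = 1`,
`s_{uv} = s_u s_v` (that is, a monoid homomorphism) and the defect free property. -/
structure IsDefectFree {m n : ℕ} {θ : Equiv.Perm (Fin m × Fin n)} {B : Type*} [CStarAlgebra B]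
    (s : Graph θ →* B) : Prop where
  isometry : ∀ u, star (s u) * s u = 1
  sum_e : ∑ i, s (e θ i) * star (s (e θ i)) = 1
  sum_f : ∑ j, s (f θ j) * star (s (f θ j)) = 1

/-- The defect free families in the nonzero unital C*-algebras of the lowest universe. -/
structure Rep {m n : ℕ} (θ : Equiv.Perm (Fin m × Fin n)) : Type 1 where
  carrier : Type
  [cstar : CStarAlgebra carrier]
  [nontriv : Nontrivial carrier]
  s : Graph θ →* carrier
  defectFree : IsDefectFree s

attribute [instance] Rep.cstar Rep.nontriv

/-- The `ℓ^∞`-product of the targets of all the defect free families. -/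
abbrev Ambient {m n : ℕ} (θ : Equiv.Perm (Fin m × Fin n)) : Type 1 :=
  lp (fun ρ : Rep θ => ρ.carrier) ∞

noncomputable instance {m n : ℕ} (θ : Equiv.Perm (Fin m × Fin n)) : CStarAlgebra (Ambient θ) where

theorem IsDefectFree.norm_le {m n : ℕ} {θ : Equiv.Perm (Fin m × Fin n)} {B : Type*}
    [CStarAlgebra B] [Nontrivial B] {s : Graph θ →* B} (hs : IsDefectFree s) (u : Graph θ) :
    ‖s u‖ ≤ 1 := by
  have h := CStarRing.norm_star_mul_self (x := s u)
  rw [hs.isometry u, norm_one] at h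
  nlinarith [norm_nonneg (s u)]

/-- The family of isometries `(ρ(u))_ρ` in the product. -/
noncomputable def ambientS {m n : ℕ} (θ : Equiv.Perm (Fin m × Fin n)) : Graph θ →* Ambient θ where
  toFun u := ⟨fun ρ => ρ.s u, memℓp_infty ⟨1, by
    rintro _ ⟨ρ, rfl⟩; exact ρ.defectFree.norm_le u⟩⟩
  map_one' := by ext ρ; simp
  map_mul' u v := by ext ρ; simp [lp.infty_coeFn_mul]

/-- The graph C*-algebra `O_θ`: the C*-subalgebra generated by the isometries `(ρ(u))_ρ`, where `ρ`
runs over all the defect free families.  Its universal property, for C*-algebras in every universe,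
is `lift`, `lift_s` and `hom_ext` below. -/
def GraphCStar {m n : ℕ} (θ : Equiv.Perm (Fin m × Fin n)) : Type 1 :=
  (StarAlgebra.adjoin ℂ (Set.range (ambientS θ))).topologicalClosure

/-- The C*-algebra structure of `O_θ`, inherited from the product. -/
noncomputable def cstarStructure {m n : ℕ} (θ : Equiv.Perm (Fin m × Fin n)) :
    CStarAlgebra (GraphCStar θ) :=
  haveI : IsClosed ((StarAlgebra.adjoin ℂ (Set.range (ambientS θ))).topologicalClosure :
    Set (Ambient θ)) := StarSubalgebra.isClosed_topologicalClosure _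
  StarSubalgebra.cstarAlgebra (StarAlgebra.adjoin ℂ (Set.range (ambientS θ))).topologicalClosure

noncomputable instance {m n : ℕ} (θ : Equiv.Perm (Fin m × Fin n)) : CStarAlgebra (GraphCStar θ) :=
  cstarStructure θ

/-- The canonical isometries `s_u` in `O_θ`. -/
noncomputable def s {m n : ℕ} (θ : Equiv.Perm (Fin m × Fin n)) : Graph θ →* GraphCStar θ where
  toFun u := ⟨ambientS θ u, StarSubalgebra.le_topologicalClosure _
    (StarAlgebra.subset_adjoin ℂ _ ⟨u, rfl⟩)⟩
  map_one' := Subtype.ext (map_one (ambientS θ))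
  map_mul' u v := Subtype.ext (map_mul (ambientS θ) u v)

/-- The inclusion of `O_θ` in the product. -/
noncomputable def incl {m n : ℕ} (θ : Equiv.Perm (Fin m × Fin n)) :
    GraphCStar θ →⋆ₐ[ℂ] Ambient θ :=
  (StarAlgebra.adjoin ℂ (Set.range (ambientS θ))).topologicalClosure.subtype

theorem incl_injective {m n : ℕ} (θ : Equiv.Perm (Fin m × Fin n)) ⦃x y : GraphCStar θ⦄
    (h : incl θ x = incl θ y) : x = y :=
  Subtype.ext h

/-- The coordinates of the product. -/
noncomputable def coord {m n : ℕ} {θ : Equiv.Perm (Fin m × Fin n)} (ρ : Rep θ) :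
    Ambient θ →⋆ₐ[ℂ] ρ.carrier where
  toFun x := x ρ
  map_one' := by simp
  map_mul' x y := by simp [lp.infty_coeFn_mul]
  map_zero' := by simp
  map_add' x y := by simp
  commutes' c := by
    rw [Algebra.algebraMap_eq_smul_one, Algebra.algebraMap_eq_smul_one]
    simp
  map_star' x := by simp

theorem s_defectFree {m n : ℕ} (θ : Equiv.Perm (Fin m × Fin n)) : IsDefectFree (s θ) where
  isometry u := by
    apply Subtype.ext
    change star (ambientS θ u) * ambientS θ u = 1
    ext ρ
    exact ρ.defectFree.isometry u
  sum_e := by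
    apply incl_injective θ
    rw [map_sum, map_one]
    change ∑ i, ambientS θ (e θ i) * star (ambientS θ (e θ i)) = 1
    ext ρ
    change coord ρ _ = coord ρ 1
    rw [map_sum, map_one]
    exact ρ.defectFree.sum_e
  sum_f := by
    apply incl_injective θ
    rw [map_sum, map_one]
    change ∑ i, ambientS θ (f θ i) * star (ambientS θ (f θ i)) = 1
    ext ρ
    change coord ρ _ = coord ρ 1
    rw [map_sum, map_one]
    exact ρ.defectFree.sum_f

/-- `O_θ` is generated by the isometries `s_u`. -/
theorem adjoin_dense {m n : ℕ} (θ : Equiv.Perm (Fin m × Fin n)) (x : GraphCStar θ) :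
    x ∈ closure (StarAlgebra.adjoin ℂ (Set.range (s θ)) : Set (GraphCStar θ)) := by
  have hemb : Topology.IsInducing (incl θ) := Topology.IsInducing.subtypeVal
  rw [hemb.closure_eq_preimage_closure_image]
  have h1 : (incl θ) '' (StarAlgebra.adjoin ℂ (Set.range (s θ)) : Set (GraphCStar θ))
      = (StarAlgebra.adjoin ℂ (Set.range (ambientS θ)) : Set (Ambient θ)) := by
    rw [← StarSubalgebra.coe_map, StarAlgHom.map_adjoin, ← Set.range_comp]
    rfl
  rw [Set.mem_preimage, h1]
  exact x.2

theorem continuous_hom {A B : Type*} [CStarAlgebra A] [CStarAlgebra B] (φ : A →⋆ₐ[ℂ] B) :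
    Continuous φ :=
  AddMonoidHomClass.continuous_of_bound φ 1 fun x => by
    rw [one_mul]; exact NonUnitalStarAlgHom.norm_apply_le φ x

theorem closure_induction {m n : ℕ} {θ : Equiv.Perm (Fin m × Fin n)} {p : GraphCStar θ → Prop}
    (hclosed : IsClosed {x | p x}) (hs : ∀ u, p (s θ u)) (hc : ∀ c : ℂ, p (algebraMap ℂ _ c))
    (hadd : ∀ x y, p x → p y → p (x + y)) (hmul : ∀ x y, p x → p y → p (x * y))
    (hstar : ∀ x, p x → p (star x)) (x : GraphCStar θ) : p x := by
  refine closure_minimal (fun y hy => ?_) hclosed (adjoin_dense θ x)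
  change p y
  induction hy using StarAlgebra.adjoin_induction with
  | mem x hx => obtain ⟨u, rfl⟩ := hx; exact hs u
  | algebraMap c => exact hc c
  | add x y _ _ hx hy => exact hadd x y hx hy
  | mul x y _ _ hx hy => exact hmul x y hx hy
  | star x _ hx => exact hstar x hx

/-- A *-homomorphism on `O_θ` is determined by its values on the isometries `s_u`. -/
theorem hom_ext {m n : ℕ} {θ : Equiv.Perm (Fin m × Fin n)} {B : Type*} [CStarAlgebra B]
    {φ ψ : GraphCStar θ →⋆ₐ[ℂ] B} (h : ∀ u, φ (s θ u) = ψ (s θ u)) : φ = ψ := by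
  ext x
  refine closure_induction (p := fun x => φ x = ψ x)
    (isClosed_eq (continuous_hom φ) (continuous_hom ψ)) h ?_ ?_ ?_ ?_ x
  · intro c; rw [AlgHomClass.commutes, AlgHomClass.commutes]
  · intro x y hx hy; rw [map_add, map_add, hx, hy]
  · intro x y hx hy; rw [map_mul, map_mul, hx, hy]
  · intro x hx; rw [map_star, map_star, hx]

/-- The C*-subalgebra generated by a family indexed by `𝔽_θ⁺` has a copy in the lowest universe. -/
theorem small_closure {m n : ℕ} {θ : Equiv.Perm (Fin m × Fin n)} {B : Type*} [CStarAlgebra B]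
    (s : Graph θ → B) :
    Small.{0} (StarAlgebra.adjoin ℂ (Set.range s)).topologicalClosure := by
  have h1 : Small.{0} (StarAlgebra.adjoin ℂ (Set.range s) : Set B) := by
    have : (StarAlgebra.adjoin ℂ (Set.range s) : Set B) =
        Set.range (FreeAlgebra.lift ℂ (Sum.elim s (fun u => star (s u)))) := by
      rw [← AlgHom.coe_range, ← Algebra.adjoin_range_eq_range_freeAlgebra_lift,
        Set.Sum.elim_range]
      change (Algebra.adjoin ℂ (Set.range s ∪ star (Set.range s)) : Set B) = _
      congr 2
      ext x
      simp only [Set.mem_union, Set.mem_star, Set.mem_range]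
      constructor
      · rintro (h | ⟨u, hu⟩)
        · exact Or.inl h
        · exact Or.inr ⟨u, by rw [hu, star_star]⟩
      · rintro (h | ⟨u, hu⟩)
        · exact Or.inl h
        · exact Or.inr ⟨u, by rw [← hu, star_star]⟩
    rw [this]
    infer_instance
  have h2 : (closure (StarAlgebra.adjoin ℂ (Set.range s) : Set B)) ⊆
      Set.range (fun g : ℕ → (StarAlgebra.adjoin ℂ (Set.range s) : Set B) =>
        Classical.epsilon (fun y : B =>
        Filter.Tendsto (fun k => (g k : B)) Filter.atTop (nhds y))) := by
    intro x hx
    obtain ⟨g, hg, hgx⟩ := mem_closure_iff_seq_limit.1 hx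
    exact ⟨fun k => ⟨g k, hg k⟩, tendsto_nhds_unique (Classical.epsilon_spec
      (p := fun y : B => Filter.Tendsto g Filter.atTop (nhds y)) ⟨x, hgx⟩) hgx⟩
  exact small_subset h2

/-- A C*-algebra whose underlying set is small has a copy in the lowest universe. -/
theorem exists_small_copy (B : Type*) [CStarAlgebra B] [Small.{0} B] :
    ∃ (C : Type) (_ : CStarAlgebra C), Nonempty (C ≃⋆ₐ[ℂ] B) := by
  let g : Shrink.{0} B ≃ₐ[ℂ] B := Shrink.algEquiv ℂ B
  let i1 : NormedRing (Shrink.{0} B) := NormedRing.induced _ B g g.injective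
  let i2 : NormedAlgebra ℂ (Shrink.{0} B) := NormedAlgebra.induced ℂ _ B g
  let i3 : StarRing (Shrink.{0} B) :=
    { star := fun x => g.symm (star (g x))
      star_involutive := fun x => by simp
      star_mul := fun x y => by simp
      star_add := fun x y => by simp }
  have hstar : ∀ x : Shrink.{0} B, g (star x) = star (g x) := fun x => g.apply_symm_apply _
  have hnorm : ∀ x : Shrink.{0} B, ‖g x‖ = ‖x‖ := fun x => rfl
  let i4 : StarModule ℂ (Shrink.{0} B) := ⟨fun c x => by
    apply g.injective; rw [hstar, map_smul, map_smul, hstar, star_smul]⟩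
  let i5 : CStarRing (Shrink.{0} B) := ⟨fun x => by
    rw [← hnorm, ← hnorm (star x * x), map_mul, hstar]
    exact CStarRing.norm_mul_self_le (g x)⟩
  let i6 : CompleteSpace (Shrink.{0} B) := by
    have hi : Isometry g := AddMonoidHomClass.isometry_of_norm g hnorm
    exact (completeSpace_congr (e := g.toEquiv) hi.isUniformEmbedding).2 inferInstance
  let i7 : CStarAlgebra (Shrink.{0} B) := { }
  exact ⟨Shrink.{0} B, i7, ⟨StarAlgEquiv.ofAlgEquiv g hstar⟩⟩

theorem exists_lift {m n : ℕ} {θ : Equiv.Perm (Fin m × Fin n)} {B : Type*} [CStarAlgebra B]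
    {t : Graph θ →* B} (ht : IsDefectFree t) :
    ∃ φ : GraphCStar θ →⋆ₐ[ℂ] B, ∀ u, φ (s θ u) = t u := by
  cases subsingleton_or_nontrivial B with
  | inl h =>
    exact ⟨{ toFun := fun _ => 0
             map_one' := Subsingleton.elim _ _
             map_mul' := fun _ _ => Subsingleton.elim _ _
             map_zero' := rfl
             map_add' := fun _ _ => Subsingleton.elim _ _
             commutes' := fun _ => Subsingleton.elim _ _
             map_star' := fun _ => Subsingleton.elim _ _ }, fun _ => Subsingleton.elim _ _⟩
  | inr h =>
    let D : StarSubalgebra ℂ B := (StarAlgebra.adjoin ℂ (Set.range t)).topologicalClosure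
    have : Small.{0} D := small_closure t
    have : IsClosed (D : Set B) := StarSubalgebra.isClosed_topologicalClosure _
    obtain ⟨C, hC, ⟨g⟩⟩ := exists_small_copy D
    have hmem : ∀ u, t u ∈ D := fun u =>
      StarSubalgebra.le_topologicalClosure _ (StarAlgebra.subset_adjoin ℂ _ ⟨u, rfl⟩)
    have : Nontrivial C := g.toEquiv.nontrivial
    have hD : ∀ ⦃x y : D⦄, D.subtype x = D.subtype y → x = y := fun x y h => Subtype.ext h
    let t' : Graph θ →* D :=
      { toFun := fun u => ⟨t u, hmem u⟩
        map_one' := Subtype.ext (map_one t)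
        map_mul' := fun u v => Subtype.ext (map_mul t u v) }
    have ht' : IsDefectFree t' :=
      { isometry := fun u => Subtype.ext (ht.isometry u)
        sum_e := by
          apply hD; rw [map_sum, map_one]; exact ht.sum_e
        sum_f := by
          apply hD; rw [map_sum, map_one]; exact ht.sum_f }
    let ρ : Rep θ :=
      { carrier := C
        s := (g.symm : D →* C).comp t'
        defectFree :=
          { isometry := fun u => by
              change star (g.symm (t' u)) * g.symm (t' u) = 1
              rw [← map_star, ← map_mul, ht'.isometry, map_one]
            sum_e := by
              change ∑ i, g.symm (t' (e θ i)) * star (g.symm (t' (e θ i))) = 1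
              simp_rw [← map_star, ← map_mul, ← map_sum, ht'.sum_e, map_one]
            sum_f := by
              change ∑ i, g.symm (t' (f θ i)) * star (g.symm (t' (f θ i))) = 1
              simp_rw [← map_star, ← map_mul, ← map_sum, ht'.sum_f, map_one] } }
    refine ⟨D.subtype.comp ((g : C →⋆ₐ[ℂ] D).comp ((coord ρ).comp (incl θ))), fun u => ?_⟩
    change ((g (g.symm (t' u)) : D) : B) = t u
    rw [StarAlgEquiv.apply_symm_apply]
    rfl

/-- The universal property of `O_θ`. -/
noncomputable def lift {m n : ℕ} {θ : Equiv.Perm (Fin m × Fin n)} {B : Type*} [CStarAlgebra B]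
    (t : Graph θ →* B) (ht : IsDefectFree t) : GraphCStar θ →⋆ₐ[ℂ] B :=
  (exists_lift ht).choose

theorem lift_s {m n : ℕ} {θ : Equiv.Perm (Fin m × Fin n)} {B : Type*} [CStarAlgebra B]
    (t : Graph θ →* B) (ht : IsDefectFree t) (u : Graph θ) : lift t ht (s θ u) = t u :=
  (exists_lift ht).choose_spec u

/-- The scalar `𝐭^{d(u)} = t₁^k t₂^l` for a word `u` of degree `(k, l)`. -/
noncomputable def weight {m n : ℕ} (θ : Equiv.Perm (Fin m × Fin n)) (z : Circle × Circle)
    (u : Graph θ) : ℂ :=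
  (z.1 : ℂ) ^ (Multiplicative.toAdd (degree θ u)).1 *
    (z.2 : ℂ) ^ (Multiplicative.toAdd (degree θ u)).2

theorem weight_one {m n : ℕ} (θ : Equiv.Perm (Fin m × Fin n)) (z : Circle × Circle) :
    weight θ z 1 = 1 := by
  simp [weight]

theorem weight_mul {m n : ℕ} (θ : Equiv.Perm (Fin m × Fin n)) (z : Circle × Circle)
    (u v : Graph θ) : weight θ z (u * v) = weight θ z u * weight θ z v := by
  simp only [weight, map_mul, toAdd_mul, Prod.fst_add, Prod.snd_add, pow_add]
  ring

theorem weight_mul_left {m n : ℕ} (θ : Equiv.Perm (Fin m × Fin n)) (z w : Circle × Circle)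
    (u : Graph θ) : weight θ (z * w) u = weight θ z u * weight θ w u := by
  simp only [weight, Prod.fst_mul, Prod.snd_mul, Circle.coe_mul, mul_pow]
  ring

theorem weight_one_left {m n : ℕ} (θ : Equiv.Perm (Fin m × Fin n)) (u : Graph θ) :
    weight θ 1 u = 1 := by
  simp [weight]

theorem star_weight {m n : ℕ} (θ : Equiv.Perm (Fin m × Fin n)) (z : Circle × Circle)
    (u : Graph θ) : star (weight θ z u) * weight θ z u = 1 := by
  have h : ‖weight θ z u‖ = 1 := by
    rw [weight, norm_mul, norm_pow, norm_pow, Circle.norm_coe, Circle.norm_coe]; simp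
  rw [Complex.star_def, Complex.conj_mul', h]
  simp

/-- The family `𝐭^{d(u)} s_u`. -/
noncomputable def gaugeFamily {m n : ℕ} (θ : Equiv.Perm (Fin m × Fin n)) (z : Circle × Circle) :
    Graph θ →* GraphCStar θ where
  toFun u := weight θ z u • s θ u
  map_one' := by rw [weight_one, map_one, one_smul]
  map_mul' u v := by rw [weight_mul, map_mul, smul_mul_smul_comm]

theorem gaugeFamily_defectFree {m n : ℕ} (θ : Equiv.Perm (Fin m × Fin n)) (z : Circle × Circle) :
    IsDefectFree (gaugeFamily θ z) where
  isometry u := by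
    change star (weight θ z u • s θ u) * (weight θ z u • s θ u) = 1
    rw [star_smul, smul_mul_smul_comm, star_weight, (s_defectFree θ).isometry, one_smul]
  sum_e := by
    rw [← (s_defectFree θ).sum_e]
    refine Finset.sum_congr rfl fun i _ => ?_
    change (weight θ z _ • s θ _) * star (weight θ z _ • s θ _) = _
    rw [star_smul, smul_mul_smul_comm, mul_comm, star_weight, one_smul]
  sum_f := by
    rw [← (s_defectFree θ).sum_f]
    refine Finset.sum_congr rfl fun i _ => ?_
    change (weight θ z _ • s θ _) * star (weight θ z _ • s θ _) = _
    rw [star_smul, smul_mul_smul_comm, mul_comm, star_weight, one_smul]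

/-- `γ_𝐭` as a *-endomorphism. -/
noncomputable def gaugeHom {m n : ℕ} (θ : Equiv.Perm (Fin m × Fin n)) (z : Circle × Circle) :
    GraphCStar θ →⋆ₐ[ℂ] GraphCStar θ :=
  lift (gaugeFamily θ z) (gaugeFamily_defectFree θ z)

theorem gaugeHom_s {m n : ℕ} (θ : Equiv.Perm (Fin m × Fin n)) (z : Circle × Circle)
    (u : Graph θ) : gaugeHom θ z (s θ u) = weight θ z u • s θ u :=
  lift_s _ (gaugeFamily_defectFree θ z) u

theorem gaugeHom_comp {m n : ℕ} (θ : Equiv.Perm (Fin m × Fin n)) (z w : Circle × Circle) :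
    (gaugeHom θ z).comp (gaugeHom θ w) = gaugeHom θ (z * w) :=
  hom_ext fun u => by
    rw [StarAlgHom.comp_apply, gaugeHom_s, gaugeHom_s, map_smul, gaugeHom_s, smul_smul,
      weight_mul_left, mul_comm]

theorem gaugeHom_one {m n : ℕ} (θ : Equiv.Perm (Fin m × Fin n)) :
    gaugeHom θ 1 = StarAlgHom.id ℂ (GraphCStar θ) :=
  hom_ext fun u => by
    rw [gaugeHom_s, weight_one_left, one_smul]; rfl

/-- The gauge automorphisms, `γ_𝐭 (s_u) = 𝐭^{d(u)} s_u`. -/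
noncomputable def gauge {m n : ℕ} (θ : Equiv.Perm (Fin m × Fin n)) (z : Circle × Circle) :
    GraphCStar θ ≃⋆ₐ[ℂ] GraphCStar θ :=
  StarAlgEquiv.ofStarAlgHom (gaugeHom θ z) (gaugeHom θ z⁻¹)
    (by rw [gaugeHom_comp, inv_mul_cancel, gaugeHom_one])
    (by rw [gaugeHom_comp, mul_inv_cancel, gaugeHom_one])

theorem gauge_s {m n : ℕ} (θ : Equiv.Perm (Fin m × Fin n)) (z : Circle × Circle)
    (u : Graph θ) : gauge θ z (s θ u) = weight θ z u • s θ u :=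
  gaugeHom_s θ z u

theorem gauge_gauge {m n : ℕ} (θ : Equiv.Perm (Fin m × Fin n)) (z w : Circle × Circle)
    (x : GraphCStar θ) : gauge θ z (gauge θ w x) = gauge θ (z * w) x :=
  DFunLike.congr_fun (gaugeHom_comp θ z w) x

theorem norm_gauge_le {m n : ℕ} (θ : Equiv.Perm (Fin m × Fin n)) (z : Circle × Circle)
    (x : GraphCStar θ) : ‖gauge θ z x‖ ≤ ‖x‖ :=
  NonUnitalStarAlgHom.norm_apply_le (gaugeHom θ z) x

/-- The gauge action is strongly continuous. -/
theorem continuous_gauge {m n : ℕ} (θ : Equiv.Perm (Fin m × Fin n)) (x : GraphCStar θ) :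
    Continuous fun z => gauge θ z x := by
  refine closure_induction (p := fun x => Continuous fun z => gauge θ z x) ?_ ?_ ?_ ?_ ?_ ?_ x
  · refine isClosed_of_closure_subset fun x hx => ?_
    refine continuous_of_uniform_approx_of_continuous fun U hU => ?_
    obtain ⟨ε, hε, hεU⟩ := Metric.mem_uniformity_dist.1 hU
    obtain ⟨y, hy, hxy⟩ := Metric.mem_closure_iff.1 hx ε hε
    refine ⟨fun z => gauge θ z y, hy, fun z => hεU ?_⟩
    rw [dist_eq_norm, ← map_sub]
    exact (norm_gauge_le θ z _).trans_lt (by rwa [← dist_eq_norm])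
  · intro u
    simp_rw [gauge_s, weight]
    fun_prop
  · intro c
    simp_rw [AlgHomClass.commutes]
    exact continuous_const
  · intro x y hx hy
    simp_rw [map_add]
    exact hx.add hy
  · intro x y hx hy
    simp_rw [map_mul]
    exact hx.mul hy
  · intro x hx
    simp_rw [map_star]
    exact hx.star

/-- The fixed point algebra `𝔉 = O_θ^γ` of the gauge action. -/
def fixedPoints {m n : ℕ} (θ : Equiv.Perm (Fin m × Fin n)) :
    StarSubalgebra ℂ (GraphCStar θ) where
  carrier := {x | ∀ z, gauge θ z x = x}
  mul_mem' hx hy z := by rw [map_mul, hx z, hy z]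
  add_mem' hx hy z := by rw [map_add, hx z, hy z]
  algebraMap_mem' c z := AlgHomClass.commutes (gauge θ z) c
  star_mem' hx z := by rw [map_star, hx z]

/-- The point `(e^{2πia}, e^{2πib})` of the 2-torus, for `a, b ∈ ℝ/ℤ`. -/
noncomputable def torus (p : UnitAddCircle × UnitAddCircle) : Circle × Circle :=
  (AddCircle.toCircle p.1, AddCircle.toCircle p.2)

theorem continuous_torus : Continuous torus :=
  (AddCircle.continuous_toCircle.comp continuous_fst).prodMk
    (AddCircle.continuous_toCircle.comp continuous_snd)

theorem torus_add (p q : UnitAddCircle × UnitAddCircle) : torus (p + q) = torus p * torus q := by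
  simp [torus, AddCircle.toCircle_add]

theorem torus_surjective : Function.Surjective torus := fun z => by
  refine ⟨((AddCircle.homeomorphCircle one_ne_zero).symm z.1,
    (AddCircle.homeomorphCircle one_ne_zero).symm z.2), ?_⟩
  simp [torus, ← AddCircle.homeomorphCircle_apply one_ne_zero]

theorem integrable_gauge {m n : ℕ} (θ : Equiv.Perm (Fin m × Fin n)) (x : GraphCStar θ) :
    MeasureTheory.Integrable fun p : UnitAddCircle × UnitAddCircle => gauge θ (torus p) x :=
  ((continuous_gauge θ x).comp continuous_torus).integrable_of_hasCompactSupport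
    (HasCompactSupport.of_compactSpace _)

theorem integral_gauge_mem {m n : ℕ} (θ : Equiv.Perm (Fin m × Fin n)) (x : GraphCStar θ) :
    ∫ p : UnitAddCircle × UnitAddCircle, gauge θ (torus p) x ∈ fixedPoints θ := by
  intro z
  obtain ⟨q, rfl⟩ := torus_surjective z
  let L : GraphCStar θ →L[ℂ] GraphCStar θ :=
    ⟨(gaugeHom θ (torus q)).toAlgHom.toLinearMap, continuous_hom _⟩
  have h := L.integral_comp_comm (integrable_gauge θ x)
  change _ = gauge θ (torus q) _ at h
  rw [← h]
  change ∫ p, gauge θ (torus q) (gauge θ (torus p) x) = _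
  simp_rw [gauge_gauge, ← torus_add]
  have : (MeasureTheory.volume :
      MeasureTheory.Measure (UnitAddCircle × UnitAddCircle)).IsAddLeftInvariant := by
    rw [MeasureTheory.Measure.volume_eq_prod]; infer_instance
  exact MeasureTheory.integral_add_left_eq_self
    (fun p : UnitAddCircle × UnitAddCircle => gauge θ (torus p) x) q

/-- The expectation `Φ(X) = ∫_{𝕋²} γ_𝐭(X) d𝐭` onto the fixed point algebra; `d𝐭` is the normalized
Haar measure of the torus, written as the Lebesgue measure of `(ℝ/ℤ)²`. -/
noncomputable def expectation {m n : ℕ} (θ : Equiv.Perm (Fin m × Fin n)) :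
    GraphCStar θ →L[ℂ] fixedPoints θ :=
  LinearMap.mkContinuous
    { toFun := fun x =>
        ⟨∫ p : UnitAddCircle × UnitAddCircle, gauge θ (torus p) x, integral_gauge_mem θ x⟩
      map_add' := fun x y => Subtype.ext <| by
        change ∫ p : UnitAddCircle × UnitAddCircle, gauge θ (torus p) (x + y) = _
        simp_rw [map_add]
        exact MeasureTheory.integral_add (integrable_gauge θ x) (integrable_gauge θ y)
      map_smul' := fun c x => Subtype.ext <| by
        change ∫ p : UnitAddCircle × UnitAddCircle, gauge θ (torus p) (c • x) = _
        simp_rw [map_smul]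
        exact MeasureTheory.integral_smul c _ } 1 (fun x => by
    change ‖∫ p : UnitAddCircle × UnitAddCircle, gauge θ (torus p) x‖ ≤ _
    have h := MeasureTheory.norm_integral_le_of_norm_le_const
      (μ := (MeasureTheory.volume : MeasureTheory.Measure (UnitAddCircle × UnitAddCircle)))
      (Filter.Eventually.of_forall fun p => norm_gauge_le θ (torus p) x)
    simpa [MeasureTheory.Measure.real, MeasureTheory.Measure.volume_eq_prod,
      ← Set.univ_prod_univ] using h)

theorem coe_expectation {m n : ℕ} (θ : Equiv.Perm (Fin m × Fin n)) (x : GraphCStar θ) :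
    (expectation θ x : GraphCStar θ) =
      ∫ p : UnitAddCircle × UnitAddCircle, gauge θ (torus p) x :=
  rfl

/-- The one-parameter automorphism group `σ` of `O_θ`,
`σ_t (s_u s_v*) = 𝐧^{it(d(v) - d(u))} s_u s_v*` where `𝐧^{(x, y)} = m^x n^y`; in terms of the gauge
action, `σ_t = γ_{(m^{-it}, n^{-it})}`. -/
noncomputable def sigma {m n : ℕ} (θ : Equiv.Perm (Fin m × Fin n)) (t : ℝ) :
    GraphCStar θ ≃⋆ₐ[ℂ] GraphCStar θ :=
  gauge θ (Circle.exp (-(t * Real.log m)), Circle.exp (-(t * Real.log n)))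

/-- The formula for `σ_t` on the standard generators. -/
theorem sigma_s_mul_star {m n : ℕ} (hm : m ≠ 0) (hn : n ≠ 0) (θ : Equiv.Perm (Fin m × Fin n))
    (t : ℝ) (u v : Graph θ) :
    sigma θ t (s θ u * star (s θ v)) =
      ((m : ℂ) ^ (Complex.I * t * ((Multiplicative.toAdd (degree θ v)).1 -
          (Multiplicative.toAdd (degree θ u)).1)) *
        (n : ℂ) ^ (Complex.I * t * ((Multiplicative.toAdd (degree θ v)).2 -
          (Multiplicative.toAdd (degree θ u)).2))) • (s θ u * star (s θ v)) := by
  have hm' : (m : ℂ) ≠ 0 := Nat.cast_ne_zero.2 hm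
  have hn' : (n : ℂ) ≠ 0 := Nat.cast_ne_zero.2 hn
  rw [sigma, map_mul, map_star, gauge_s, gauge_s, star_smul, smul_mul_smul_comm]
  congr 1
  rw [weight, weight, Complex.cpow_def_of_ne_zero hm', Complex.cpow_def_of_ne_zero hn',
    Complex.star_def, map_mul, map_pow, map_pow]
  simp only [Circle.coe_exp, ← Complex.exp_conj, ← Complex.exp_nat_mul, ← Complex.exp_add,
    ← Complex.natCast_log, map_mul, Complex.conj_ofReal, Complex.conj_I]
  congr 1
  push_cast
  ring

/-- A state: a positive (continuous) linear functional with value `1` at the unit. -/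
structure IsState {A : Type*} [NormedRing A] [StarRing A] [NormedAlgebra ℂ A]
    (φ : A →L[ℂ] ℂ) : Prop where
  nonneg : ∀ a, 0 ≤ φ (star a * a)
  map_one : φ 1 = 1

/-- A tracial state. -/
structure IsTracialState {A : Type*} [NormedRing A] [StarRing A] [NormedAlgebra ℂ A]
    (φ : A →L[ℂ] ℂ) : Prop extends IsState φ where
  map_mul_comm : ∀ a b, φ (a * b) = φ (b * a)

/-- `F` is the entire extension `z ↦ α_z(a)` of the orbit `t ↦ α_t(a)`. -/
structure IsEntireOrbit {A : Type*} [CStarAlgebra A] (α : ℝ → A ≃⋆ₐ[ℂ] A) (a : A)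
    (F : ℂ → A) : Prop where
  differentiable : Differentiable ℂ F
  apply_ofReal : ∀ t : ℝ, F t = α t a

/-- `a` is entire for `α`. -/
def IsEntire {A : Type*} [CStarAlgebra A] (α : ℝ → A ≃⋆ₐ[ℂ] A) (a : A) : Prop :=
  ∃ F : ℂ → A, IsEntireOrbit α a F

/-- `φ` is an `α`-KMS state at value `β`: a state with `φ(ab) = φ(b α_{iβ}(a))` for all `a`, `b`
entire for `α`. -/
structure IsKMSStateAt {A : Type*} [CStarAlgebra A] (α : ℝ → A ≃⋆ₐ[ℂ] A) (β : ℝ)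
    (φ : A →L[ℂ] ℂ) : Prop extends IsState φ where
  kms : ∀ (a b : A) (F : ℂ → A), IsEntireOrbit α a F → IsEntire α b →
    φ (a * b) = φ (b * F (Complex.I * β))

/-- An `α`-KMS state is an `α`-KMS state at value `-1`. -/
def IsKMSState {A : Type*} [CStarAlgebra A] (α : ℝ → A ≃⋆ₐ[ℂ] A) (φ : A →L[ℂ] ℂ) : Prop :=
  IsKMSStateAt α (-1) φ

/-- The state `τ ∘ Φ` of `O_θ` induced by the tracial state `τ` of the fixed point algebra; it is
the distinguished state `ω` when `τ` is the unique tracial state. -/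
noncomputable def inducedState {m n : ℕ} (θ : Equiv.Perm (Fin m × Fin n))
    (τ : fixedPoints θ →L[ℂ] ℂ) : GraphCStar θ →L[ℂ] ℂ :=
  τ.comp (expectation θ)

end RankTwoGraph

/-! Everything rests on one averaging map. The `mn` isometries `S_p = s_{e_i f_j}` form a Cuntz
family: orthogonal ranges with range projections summing to `1`. Put `N = mn` and `Ψ(x) = N⁻¹ ∑ S_p*
x S_p`. The claim is that `Ψ^k(x)` converges in norm to a scalar `ω(x)` for every `x` in `O_id`; the
existence and both uniqueness statements are then read off from `ω`.

Convergence (`exists_averagesTo_ef`). Since the `e` family commutes with the `f` family and with its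
adjoints, every monomial is `ab` with `a` a monomial in the `e` isometries and `b` one in the `f`
isometries, and `Ψ^k(ab)` is the product of the separate averages. For a single Cuntz family of size
at least 2, a monomial is `0` or `S_u S_v*`. Averaging strips the first letters of `u` and `v`,
giving `0` if they differ. Once one word is empty and the other is not, averaging only rotates the
remaining word cyclically and divides it by the size of the family, so the limit is `0`.
Contractivity of `Ψ` extends convergence to the closed span.

KMS (`isKMSState_limit`). A unital continuous map commuting with `Ψ` preserves `ω`. Applied to the
separate `e` and `f` averages this gives `ω(a s_{e_i}) = m ω(s_{e_i} a)` and `ω(a s_{f_j}) = n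
ω(s_{f_j} a)`, which is the KMS relation on generators; applied to the gauge automorphisms it gives
gauge invariance, so `ω` is its restriction to `𝔉` composed with `Φ`. Analytic continuation handles
an arbitrary entire element.

Uniqueness. A KMS state `φ` satisfies `φ ∘ Ψ = φ`, so `φ(x) = φ(Ψ^k(x)) → ω(x)`
(`eq_of_isKMSState`). For a trace `τ` on `𝔉` the `S_p` themselves are unavailable, but the `S_p
S_q*` lie in `𝔉`. With `α(x) = ∑ S_p x S_p*` the trace property gives `τ(α^k(Ψ^k(x))) = τ(x)`, and
`α^k(Ψ^k(x))` tends to the same scalar because `α` is contractive and fixes scalars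
(`IsCuntzFamily.trace_eq`). No arithmetic relation between `ln m` and `ln n` plays a role. -/

open scoped ComplexOrder

/-! ### Cuntz families and their averaging maps -/

/-- A finite family of isometries in a unital C*-algebra whose range projections sum to `1`. -/
structure IsCuntzFamily {ι A : Type*} [Fintype ι] [CStarAlgebra A] (S : ι → A) : Prop where
  isometry : ∀ i, star (S i) * S i = 1
  sum_eq_one : ∑ i, S i * star (S i) = 1

/-- The map `x ↦ |ι|⁻¹ ∑ i, S i* x S i`. -/
noncomputable def cuntzAverage {ι A : Type*} [Fintype ι] [CStarAlgebra A] (S : ι → A) : A →L[ℂ] A :=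
  (Fintype.card ι : ℂ)⁻¹ • ∑ i, (ContinuousLinearMap.mul ℂ A (star (S i))).comp
    ((ContinuousLinearMap.mul ℂ A).flip (S i))

section CuntzFamily

variable {ι A : Type*} [Fintype ι] [CStarAlgebra A] {S : ι → A}

theorem cuntzAverage_apply (S : ι → A) (x : A) :
    cuntzAverage S x = (Fintype.card ι : ℂ)⁻¹ • ∑ i, star (S i) * (x * S i) := by
  simp [cuntzAverage]

theorem cuntzAverage_star (S : ι → A) (x : A) :
    cuntzAverage S (star x) = star (cuntzAverage S x) := by
  simp [cuntzAverage_apply, mul_assoc]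

theorem cuntzAverage_pow_star (S : ι → A) (k : ℕ) (x : A) :
    (cuntzAverage S ^ k) (star x) = star ((cuntzAverage S ^ k) x) := by
  induction k generalizing x with
  | zero => simp
  | succ k ih => rw [pow_succ, mul_apply_eq_comp, cuntzAverage_star, ih,
      mul_apply_eq_comp]

/-- Averages over commuting families commute. -/
theorem commute_cuntzAverage {κ : Type*} [Fintype κ] {T : κ → A}
    (h : ∀ i j, S i * T j = T j * S i) : Commute (cuntzAverage S) (cuntzAverage T) := by
  have h' : ∀ i j, star (S i) * star (T j) = star (T j) * star (S i) := fun i j => by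
    rw [← star_mul, ← star_mul, h]
  ext x
  simp only [mul_apply_eq_comp, cuntzAverage_apply, mul_smul_comm, smul_mul_assoc,
    Finset.mul_sum, Finset.sum_mul, ← Finset.smul_sum]
  rw [smul_comm, Finset.sum_comm]
  congr 2
  refine Finset.sum_congr rfl fun j _ => Finset.sum_congr rfl fun i _ => ?_
  calc star (S i) * (star (T j) * (x * T j) * S i)
      = star (S i) * star (T j) * x * (T j * S i) := by simp only [mul_assoc]
    _ = star (T j) * star (S i) * x * (S i * T j) := by rw [h', h]
    _ = _ := by simp only [mul_assoc]

/-- An average only sees the factor which does not commute with the family. -/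
theorem cuntzAverage_mul_left {a b : A} (h : ∀ i, b * S i = S i * b) :
    cuntzAverage S (a * b) = cuntzAverage S a * b := by
  simp only [cuntzAverage_apply, smul_mul_assoc, Finset.sum_mul, mul_assoc, h]

theorem cuntzAverage_mul_right {a b : A} (h : ∀ i, star (S i) * a = a * star (S i)) :
    cuntzAverage S (a * b) = a * cuntzAverage S b := by
  simp only [cuntzAverage_apply, mul_smul_comm, Finset.mul_sum]
  congr 1
  refine Finset.sum_congr rfl fun i _ => ?_
  rw [mul_assoc, ← mul_assoc, h, mul_assoc]

namespace IsCuntzFamily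

theorem norm_le (hS : IsCuntzFamily S) (i : ι) : ‖S i‖ ≤ 1 := by
  cases subsingleton_or_nontrivial A with
  | inl h => rw [Subsingleton.elim (S i) 0, norm_zero]; exact zero_le_one
  | inr h =>
    have h := CStarRing.norm_star_mul_self (x := S i)
    rw [hS.isometry i, norm_one] at h
    nlinarith [norm_nonneg (S i)]

theorem norm_cuntzAverage_le (hS : IsCuntzFamily S) (x : A) : ‖cuntzAverage S x‖ ≤ ‖x‖ := by
  rw [cuntzAverage_apply, norm_smul, norm_inv, Complex.norm_natCast]
  have h : ‖∑ i, star (S i) * (x * S i)‖ ≤ Fintype.card ι * ‖x‖ := by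
    refine (norm_sum_le _ _).trans ?_
    rw [← nsmul_eq_mul]
    refine Finset.sum_le_card_nsmul _ _ _ fun i _ => ?_
    have h1 := hS.norm_le i
    calc ‖star (S i) * (x * S i)‖ ≤ ‖star (S i)‖ * (‖x‖ * ‖S i‖) :=
          (norm_mul_le _ _).trans (by gcongr; exact norm_mul_le _ _)
      _ ≤ 1 * (‖x‖ * 1) := by rw [norm_star]; gcongr
      _ = ‖x‖ := by ring
  rcases Nat.eq_zero_or_pos (Fintype.card ι) with h0 | h0
  · simp [h0]
  · rw [inv_mul_le_iff₀ (by exact_mod_cast h0)]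
    exact h

theorem norm_cuntzAverage_pow_le (hS : IsCuntzFamily S) (k : ℕ) (x : A) :
    ‖(cuntzAverage S ^ k) x‖ ≤ ‖x‖ := by
  induction k generalizing x with
  | zero => simp
  | succ k ih => exact (ih _).trans (hS.norm_cuntzAverage_le x)

theorem cuntzAverage_one [Nonempty ι] (hS : IsCuntzFamily S) : cuntzAverage S 1 = 1 := by
  simp only [cuntzAverage_apply, one_mul, hS.isometry]
  rw [Finset.sum_const, Finset.card_univ, ← Nat.cast_smul_eq_nsmul ℂ, smul_smul, inv_mul_cancel₀,
    one_smul]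
  exact_mod_cast Fintype.card_ne_zero

theorem cuntzAverage_pow_one [Nonempty ι] (hS : IsCuntzFamily S) (k : ℕ) :
    (cuntzAverage S ^ k) 1 = 1 := by
  induction k with
  | zero => simp
  | succ k ih => rw [pow_succ, mul_apply_eq_comp, hS.cuntzAverage_one, ih]

/-- Compress `∑ S_k S_k* = 1` by `S_j`: the term `k = j` already equals `1`, so the remaining terms,
which are positive, sum to zero and each vanishes. -/
theorem star_mul_eq_zero (hS : IsCuntzFamily S) {i j : ι} (hij : i ≠ j) :
    star (S i) * S j = 0 := by
  classical
  let := CStarAlgebra.spectralOrder A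
  have := CStarAlgebra.spectralOrderedRing A
  have h1 : ∑ k, star (S j) * (S k * star (S k)) * S j = 1 := by
    rw [← Finset.sum_mul, ← Finset.mul_sum, hS.sum_eq_one, mul_one, hS.isometry]
  have h2 : star (S j) * (S j * star (S j)) * S j = 1 := by
    rw [← mul_assoc, hS.isometry, one_mul, hS.isometry]
  rw [← Finset.add_sum_erase _ _ (Finset.mem_univ j), h2, add_eq_left] at h1
  have h3 := (Finset.sum_eq_zero_iff_of_nonneg (fun k _ => ?_)).1 h1 i (by simp [hij])
  · rw [← CStarRing.star_mul_self_eq_zero_iff, star_mul, star_star, ← h3]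
    simp only [mul_assoc]
  · have : star (S j) * (S k * star (S k)) * S j = star (star (S k) * S j) * (star (S k) * S j) := by
      simp [mul_assoc]
    rw [this]
    exact star_mul_self_nonneg _

theorem star_mul_eq_ite [DecidableEq ι] (hS : IsCuntzFamily S) (i j : ι) :
    star (S i) * S j = if i = j then 1 else 0 := by
  split_ifs with h
  · rw [h, hS.isometry]
  · exact hS.star_mul_eq_zero h

/-- Products of two families which commute. -/
theorem mul {κ : Type*} [Fintype κ] {T : κ → A} (hS : IsCuntzFamily S) (hT : IsCuntzFamily T) :
    IsCuntzFamily fun p : ι × κ => S p.1 * T p.2 where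
  isometry p := by
    rw [star_mul, mul_assoc, ← mul_assoc (star (S p.1)), hS.isometry, one_mul, hT.isometry]
  sum_eq_one := by
    rw [Fintype.sum_prod_type, ← hS.sum_eq_one]
    refine Finset.sum_congr rfl fun i _ => ?_
    calc ∑ j, S i * T j * star (S i * T j) = S i * (∑ j, T j * star (T j)) * star (S i) := by
          simp only [Finset.mul_sum, Finset.sum_mul, star_mul, mul_assoc]
      _ = S i * star (S i) := by rw [hT.sum_eq_one, mul_one]

/-- One average strips the leading letters of both words; this is the reduction step on `S_u S_v*`.
-/
theorem cuntzAverage_cons_cons [DecidableEq ι] (hS : IsCuntzFamily S) (i j : ι) (a b : A) :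
    cuntzAverage S (S i * a * star (S j * b)) =
      (Fintype.card ι : ℂ)⁻¹ • (if i = j then a * star b else 0) := by
  rw [cuntzAverage_apply]
  congr 1
  have h : ∀ k, star (S k) * (S i * a * star (S j * b) * S k) =
      if k = i then (if j = k then a * star b else 0) else 0 := fun k => by
    calc _ = (star (S k) * S i) * (a * star b) * (star (S j) * S k) := by
          simp only [star_mul, mul_assoc]
      _ = _ := by
          rw [hS.star_mul_eq_ite, hS.star_mul_eq_ite]
          split_ifs <;> simp
  simp only [h, Finset.sum_ite_eq', Finset.mem_univ, if_true, @eq_comm _ j i]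

/-- With no adjoint on the right, averaging moves the first letter to the end. The same identity
later turns invariance under the average into the KMS relation. -/
theorem cuntzAverage_cons (hS : IsCuntzFamily S) (i : ι) (a : A) :
    cuntzAverage S (S i * a) = (Fintype.card ι : ℂ)⁻¹ • (a * S i) := by
  classical
  rw [cuntzAverage_apply]
  congr 1
  have h : ∀ k, star (S k) * (S i * a * S k) = if k = i then a * S k else 0 := fun k => by
    rw [mul_assoc, ← mul_assoc, hS.star_mul_eq_ite]
    split_ifs <;> simp
  simp only [h, Finset.sum_ite_eq', Finset.mem_univ, if_true]

theorem norm_word_le (hS : IsCuntzFamily S) (u : List ι) : ‖(u.map S).prod‖ ≤ ‖(1 : A)‖ := by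
  induction u with
  | nil => simp
  | cons i u ih =>
    rw [List.map_cons, List.prod_cons]
    have h1 := hS.norm_le i
    have h2 := norm_nonneg (u.map S).prod
    exact (norm_mul_le _ _).trans (by nlinarith)

/-- Rotation keeps the word nonempty, so each average gains another factor `1 / |ι|` while the norms
of words stay bounded. -/
theorem norm_cuntzAverage_pow_word_le (hS : IsCuntzFamily S) (k : ℕ) (i : ι) (u : List ι) :
    ‖(cuntzAverage S ^ k) ((i :: u).map S).prod‖ ≤ ((Fintype.card ι : ℝ)⁻¹) ^ k * ‖(1 : A)‖ := by
  induction k generalizing i u with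
  | zero => simpa using hS.norm_word_le (i :: u)
  | succ k ih =>
    rw [pow_succ, mul_apply_eq_comp, List.map_cons, List.prod_cons,
      hS.cuntzAverage_cons, map_smul, norm_smul, norm_inv, Complex.norm_natCast]
    have h : (u.map S).prod * S i = ((u ++ [i]).map S).prod := by simp
    rw [h, pow_succ']
    cases u with
    | nil => rw [mul_assoc]; gcongr; exact ih i []
    | cons j u => rw [mul_assoc]; gcongr; exact ih j (u ++ [i])

end IsCuntzFamily

/-! ### Convergence of the iterated averages to scalars -/

/-- The iterated averages of `x` converge to the scalar `c`. -/
def AveragesTo (S : ι → A) (x : A) (c : ℂ) : Prop :=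
  Filter.Tendsto (fun k => (cuntzAverage S ^ k) x) Filter.atTop (nhds (algebraMap ℂ A c))

theorem AveragesTo.of_cuntzAverage {x : A} {c : ℂ} (h : AveragesTo S (cuntzAverage S x) c) :
    AveragesTo S x c := by
  refine (Filter.tendsto_add_atTop_iff_nat 1).1 (h.congr fun k => ?_)
  rw [pow_succ, mul_apply_eq_comp]

theorem AveragesTo.add {x y : A} {c d : ℂ} (hx : AveragesTo S x c) (hy : AveragesTo S y d) :
    AveragesTo S (x + y) (c + d) := by
  unfold AveragesTo
  simp only [map_add]
  exact Filter.Tendsto.add hx hy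

theorem AveragesTo.smul {x : A} {c : ℂ} (hx : AveragesTo S x c) (r : ℂ) :
    AveragesTo S (r • x) (r * c) := by
  unfold AveragesTo
  simp only [map_smul]
  rw [map_mul, ← Algebra.smul_def]
  exact Filter.Tendsto.const_smul hx r

theorem AveragesTo.star {x : A} {c : ℂ} (hx : AveragesTo S x c) :
    AveragesTo S (star x) (star c) := by
  unfold AveragesTo
  simp only [cuntzAverage_pow_star]
  rw [algebraMap_star_comm]
  exact Filter.Tendsto.star hx

theorem averagesTo_zero (S : ι → A) : AveragesTo S 0 0 := by
  simp [AveragesTo]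

theorem IsCuntzFamily.averagesTo_one [Nonempty ι] (hS : IsCuntzFamily S) : AveragesTo S 1 1 := by
  simp [AveragesTo, hS.cuntzAverage_pow_one]

theorem AveragesTo.unique [Nontrivial A] {x : A} {c d : ℂ} (h : AveragesTo S x c)
    (h' : AveragesTo S x d) : c = d :=
  (algebraMap ℂ A).injective (tendsto_nhds_unique h h')

theorem AveragesTo.norm_le [Nontrivial A] (hS : IsCuntzFamily S) {x : A} {c : ℂ}
    (h : AveragesTo S x c) : ‖c‖ ≤ ‖x‖ := by
  have := le_of_tendsto (Filter.Tendsto.norm h)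
    (Filter.Eventually.of_forall fun k => hS.norm_cuntzAverage_pow_le k x)
  rwa [norm_algebraMap'] at this

/-- Averages are positive maps and the positive cone is closed, so `c • 1` is positive; as the
algebra is nonzero, `c` is in its spectrum. -/
theorem AveragesTo.nonneg [Nontrivial A] {a : A} {c : ℂ} (h : AveragesTo S (Star.star a * a) c) :
    0 ≤ c := by
  let := CStarAlgebra.spectralOrder A
  have := CStarAlgebra.spectralOrderedRing A
  have key : ∀ x : A, 0 ≤ x → 0 ≤ cuntzAverage S x := fun x hx => by
    rw [cuntzAverage_apply, ← Complex.ofReal_natCast, ← Complex.ofReal_inv, Complex.coe_smul]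
    refine smul_nonneg (by positivity) (Finset.sum_nonneg fun i _ => ?_)
    rw [← mul_assoc]
    exact star_left_conjugate_nonneg hx _
  have hpow : ∀ k (x : A), 0 ≤ x → 0 ≤ (cuntzAverage S ^ k) x := fun k => by
    induction k with
    | zero => intro x hx; simpa using hx
    | succ k ih => intro x hx; rw [pow_succ]; exact ih _ (key x hx)
  have h0 : 0 ≤ algebraMap ℂ A c :=
    ge_of_tendsto h (Filter.Eventually.of_forall fun k => hpow k _ (star_mul_self_nonneg a))
  exact spectrum_nonneg_of_nonneg h0 (by rw [spectrum.scalar_eq]; exact Set.mem_singleton c)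

/-- The elements with convergent averages form a closed set. -/
theorem IsCuntzFamily.isClosed_averagesTo (hS : IsCuntzFamily S) :
    IsClosed {x : A | ∃ c, AveragesTo S x c} := by
  cases subsingleton_or_nontrivial A with
  | inl h => exact Set.toFinite _ |>.isClosed
  | inr h =>
    refine isClosed_of_closure_subset fun x hx => ?_
    obtain ⟨y, hy, hyx⟩ := mem_closure_iff_seq_limit.1 hx
    choose c hc using hy
    -- The limit scalar depends contractively on the element, so the scalars `c p` are Cauchy
    -- together with the `y p`.
    have hd : ∀ p q, ‖c p - c q‖ ≤ ‖y p - y q‖ := fun p q => by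
      have h := (hc p).add ((hc q).smul (-1))
      simpa [sub_eq_add_neg] using h.norm_le hS
    have hcau : CauchySeq c := by
      have hy' := hyx.cauchySeq
      rw [Metric.cauchySeq_iff] at hy' ⊢
      intro ε hε
      obtain ⟨N, hN⟩ := hy' ε hε
      refine ⟨N, fun p hp q hq => lt_of_le_of_lt ?_ (hN p hp q hq)⟩
      rw [dist_eq_norm, dist_eq_norm]; exact hd p q
    obtain ⟨d, hd⟩ := cauchySeq_tendsto_of_complete hcau
    refine ⟨d, ?_⟩
    rw [AveragesTo, Metric.tendsto_atTop]
    intro ε hε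
    obtain ⟨p, hp1, hp2⟩ := ((Metric.tendsto_nhds.1 hyx (ε / 3) (by positivity)).and
      -- An `ε / 3` argument: `x` against `y p` uniformly in the number of averages, the averages of
      -- `y p` against `c p`, and `c p` against `d`.
      (Metric.tendsto_nhds.1 hd (ε / 3) (by positivity))).exists
    obtain ⟨N, hN⟩ := Metric.tendsto_atTop.1 (hc p) (ε / 3) (by positivity)
    refine ⟨N, fun k hk => ?_⟩
    have h1 : dist ((cuntzAverage S ^ k) x) ((cuntzAverage S ^ k) (y p)) < ε / 3 := by
      rw [dist_eq_norm, ← map_sub]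
      refine (hS.norm_cuntzAverage_pow_le k _).trans_lt ?_
      rwa [← dist_eq_norm, dist_comm]
    have h2 : dist (algebraMap ℂ A (c p)) (algebraMap ℂ A d) < ε / 3 := by
      rwa [dist_eq_norm, ← map_sub, norm_algebraMap', ← dist_eq_norm]
    have h3 := hN k hk
    have h4 := dist_triangle4 ((cuntzAverage S ^ k) x) ((cuntzAverage S ^ k) (y p))
      (algebraMap ℂ A (c p)) (algebraMap ℂ A d)
    linarith

/-- At least two isometries are needed: for a single one the average would rotate the word without
any decay. -/
theorem IsCuntzFamily.averagesTo_word (hS : IsCuntzFamily S) (hι : 1 < Fintype.card ι) (i : ι)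
    (u : List ι) : AveragesTo S ((i :: u).map S).prod 0 := by
  rw [AveragesTo, map_zero]
  refine squeeze_zero_norm (fun k => hS.norm_cuntzAverage_pow_word_le k i u) ?_
  rw [← zero_mul ‖(1 : A)‖]
  refine Filter.Tendsto.mul_const _ (tendsto_pow_atTop_nhds_zero_of_lt_one (by positivity) ?_)
  exact inv_lt_one_of_one_lt₀ (by exact_mod_cast hι)

/-- Strip first letters in pairs until one word is empty: two empty words give `1`, a remaining
nonempty word averages to `0`, as does its adjoint. -/
theorem IsCuntzFamily.exists_averagesTo_word (hS : IsCuntzFamily S) (hι : 1 < Fintype.card ι)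
    (u v : List ι) : ∃ c, AveragesTo S ((u.map S).prod * Star.star (v.map S).prod) c := by
  classical
  have : Nonempty ι := Fintype.card_pos_iff.1 (zero_lt_one.trans hι)
  induction u generalizing v with
  | nil =>
    cases v with
    | nil => exact ⟨1, by simpa using hS.averagesTo_one⟩
    | cons j v => exact ⟨star 0, by simpa using (hS.averagesTo_word hι j v).star⟩
  | cons i u ih =>
    cases v with
    | nil => exact ⟨0, by simpa using hS.averagesTo_word hι i u⟩
    | cons j v =>
      obtain ⟨c, hc⟩ := ih v
      have h : ∃ c, AveragesTo S (cuntzAverage S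
          (((i :: u).map S).prod * Star.star ((j :: v).map S).prod)) c := by
        simp only [List.map_cons, List.prod_cons]
        rw [hS.cuntzAverage_cons_cons]
        split_ifs
        · exact ⟨_, hc.smul _⟩
        · exact ⟨_, (averagesTo_zero S).smul _⟩
      exact ⟨_, h.choose_spec.of_cuntzAverage⟩

/-- The averages converge on the multiplicative closure of a Cuntz family and its adjoints. -/
theorem IsCuntzFamily.exists_averagesTo (hS : IsCuntzFamily S) (hι : 1 < Fintype.card ι) {x : A}
    (hx : x ∈ Submonoid.closure (Set.range S ∪ star (Set.range S))) : ∃ c, AveragesTo S x c := by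
  classical
  -- Normal form: multiplying `S_u S_v*` on the left by `S_i*` cancels the first letter of `u`,
  -- gives zero, or, if `u` is empty, appends `i` to `v` (at the end, since adjoints reverse
  -- products).
  have key : x = 0 ∨ ∃ u v : List ι, x = (u.map S).prod * Star.star (v.map S).prod := by
    induction hx using Submonoid.closure_induction_left with
    | one => exact Or.inr ⟨[], [], by simp⟩
    | mul_left a ha y _ ih =>
      rcases ih with rfl | ⟨u, v, rfl⟩
      · simp
      rcases ha with ⟨i, rfl⟩ | ⟨i, hi⟩
      · exact Or.inr ⟨i :: u, v, by simp [mul_assoc]⟩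
      · obtain rfl : a = Star.star (S i) := by rw [hi, star_star]
        cases u with
        | nil => exact Or.inr ⟨[], v ++ [i], by simp⟩
        | cons j u =>
          rw [List.map_cons, List.prod_cons, mul_assoc, ← mul_assoc, hS.star_mul_eq_ite]
          split_ifs
          · exact Or.inr ⟨u, v, by rw [one_mul]⟩
          · exact Or.inl (zero_mul _)
  rcases key with rfl | ⟨u, v, rfl⟩
  · exact ⟨0, averagesTo_zero S⟩
  · exact hS.exists_averagesTo_word hι u v

/-- Averages over the products of two commuting families. -/
theorem cuntzAverage_mul {κ : Type*} [Fintype κ] (S : ι → A) (T : κ → A) :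
    cuntzAverage (fun p : ι × κ => S p.1 * T p.2) = cuntzAverage T * cuntzAverage S := by
  ext x
  simp only [mul_apply_eq_comp, cuntzAverage_apply, mul_smul_comm, smul_mul_assoc,
    Finset.mul_sum, Finset.sum_mul, ← Finset.smul_sum, smul_smul, Fintype.card_prod]
  rw [Fintype.sum_prod_type, Finset.sum_comm, Nat.cast_mul, mul_inv, mul_comm (Fintype.card ι : ℂ)⁻¹]
  simp only [star_mul, mul_assoc]

theorem cuntzAverage_mem {B : StarSubalgebra ℂ A} (hB : ∀ i, S i ∈ B) {x : A} (hx : x ∈ B) :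
    cuntzAverage S x ∈ B := by
  rw [cuntzAverage_apply]
  exact B.smul_mem (sum_mem fun i _ => mul_mem (star_mem (hB i)) (mul_mem hx (hB i))) _

/-- If two families doubly commute, then the averages over their products converge on the products
of elements with convergent averages. -/
theorem AveragesTo.mul {κ : Type*} [Fintype κ] {T : κ → A} {B C : StarSubalgebra ℂ A}
    (hBC : ∀ b ∈ B, ∀ c ∈ C, b * c = c * b) (hS : ∀ i, S i ∈ B) (hT : ∀ j, T j ∈ C) {b c : A}
    (hb : b ∈ B) (hc : c ∈ C) {r t : ℂ} (hr : AveragesTo S b r) (ht : AveragesTo T c t) :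
    AveragesTo (fun p : ι × κ => S p.1 * T p.2) (b * c) (r * t) := by
  -- The average over `S` passes by `c`, and the average over `T` passes by the averaged `b`, which
  -- stays in `B`. The statement is for all `b` and `c` so that the induction can be applied to
  -- their averages.
  have key : ∀ k, ∀ b ∈ B, ∀ c ∈ C, (cuntzAverage (fun p : ι × κ => S p.1 * T p.2) ^ k) (b * c) =
      (cuntzAverage S ^ k) b * (cuntzAverage T ^ k) c := fun k => by
    induction k with
    | zero => simp
    | succ k ih =>
      intro b hb c hc
      have hb' := cuntzAverage_mem hS hb
      simp only [pow_succ, mul_apply_eq_comp]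
      rw [cuntzAverage_mul, mul_apply_eq_comp,
        cuntzAverage_mul_left fun i => (hBC _ (hS i) _ hc).symm,
        cuntzAverage_mul_right fun j => (hBC _ hb' _ (star_mem (hT j))).symm,
        ← cuntzAverage_mul, ih _ hb' _ (cuntzAverage_mem hT hc)]
  unfold AveragesTo
  simp only [key _ b hb c hc, map_mul]
  exact Filter.Tendsto.mul hr ht

/-- The *-endomorphism `x ↦ ∑ i, S i x S i*`. -/
noncomputable def IsCuntzFamily.endomorphism (hS : IsCuntzFamily S) : A →⋆ₐ[ℂ] A where
  toFun x := ∑ i, S i * x * Star.star (S i)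
  map_one' := by simp [hS.sum_eq_one]
  map_mul' x y := by
    classical
    have h : ∀ i j, S i * x * Star.star (S i) * (S j * y * Star.star (S j)) =
        if i = j then S i * (x * y) * Star.star (S j) else 0 := fun i j => by
      calc _ = S i * x * (Star.star (S i) * S j) * y * Star.star (S j) := by simp only [mul_assoc]
        _ = _ := by rw [hS.star_mul_eq_ite]; split_ifs <;> simp [mul_assoc]
    simp only [Finset.sum_mul_sum, h, Finset.sum_ite_eq, Finset.mem_univ, if_true]
  map_zero' := by simp
  map_add' x y := by simp [mul_add, add_mul, Finset.sum_add_distrib]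
  commutes' r := by
    simp only [← Algebra.commutes r (S _), mul_assoc]
    rw [← Finset.mul_sum, hS.sum_eq_one, mul_one]
  map_star' x := by simp [mul_assoc]

theorem IsCuntzFamily.endomorphism_apply (hS : IsCuntzFamily S) (x : A) :
    hS.endomorphism x = ∑ i, S i * x * Star.star (S i) :=
  rfl

end CuntzFamily

/-! ### Cuntz families on `ℓ²(X)` from partitions of `X` -/

open scoped ENNReal

section Pullback

variable {X : Type*}

/-- The operator `ξ ↦ ξ ∘ φ` on `ℓ²(X)`, for an injective map `φ`. -/
noncomputable def lpPullback (φ : X → X) (hφ : Function.Injective φ) :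
    lp (fun _ : X => ℂ) 2 →L[ℂ] lp (fun _ : X => ℂ) 2 :=
  LinearMap.mkContinuous
    { toFun := fun ξ => ⟨fun x => ξ (φ x), memℓp_gen
        (((lp.memℓp ξ).summable (by simp)).comp_injective hφ)⟩
      map_add' := fun ξ η => rfl
      map_smul' := fun c ξ => rfl } 1 (fun ξ => by
    rw [one_mul]
    refine lp.norm_le_of_tsum_le (by simp) (norm_nonneg _) ?_
    rw [lp.norm_rpow_eq_tsum (by simp)]
    exact tsum_comp_le_tsum_of_inj ((lp.memℓp ξ).summable (by simp)) (fun x => by positivity) hφ)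

theorem lpPullback_apply (φ : X → X) (hφ : Function.Injective φ) (ξ : lp (fun _ : X => ℂ) 2)
    (x : X) : lpPullback φ hφ ξ x = ξ (φ x) :=
  rfl

variable [DecidableEq X]

theorem lpPullback_single (φ : X → X) (hφ : Function.Injective φ) (x : X) (c : ℂ) :
    lpPullback φ hφ (lp.single 2 (φ x) c) = lp.single 2 x c := by
  ext y
  rw [lpPullback_apply, lp.single_apply, lp.single_apply]
  simp only [Pi.single_apply, hφ.eq_iff]

theorem lpPullback_single_of_notMem (φ : X → X) (hφ : Function.Injective φ) {x : X}
    (hx : x ∉ Set.range φ) (c : ℂ) : lpPullback φ hφ (lp.single 2 x c) = 0 := by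
  ext y
  rw [lpPullback_apply, lp.single_apply, Pi.single_apply, if_neg fun h => hx ⟨y, h⟩]
  rfl

theorem star_lpPullback_single (φ : X → X) (hφ : Function.Injective φ) (x : X) (c : ℂ) :
    star (lpPullback φ hφ) (lp.single 2 x c) = lp.single 2 (φ x) c := by
  refine ext_inner_right ℂ fun ξ => ?_
  rw [ContinuousLinearMap.star_eq_adjoint, ContinuousLinearMap.adjoint_inner_left,
    lp.inner_single_left, lp.inner_single_left, lpPullback_apply]

/-- The adjoint of pullback by `φ i` is the isometry `δ_x ↦ δ_{φ i x}`. Joint bijectivity says that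
the ranges of the `φ i` partition `X`, so the range projections sum to `1`. -/
theorem isCuntzFamily_star_lpPullback {ι : Type*} [Fintype ι] (φ : ι → X → X)
    (hφ : Function.Bijective fun p : ι × X => φ p.1 p.2) (hφ' : ∀ i, Function.Injective (φ i)) :
    IsCuntzFamily fun i => star (lpPullback (φ i) (hφ' i)) where
  isometry i := by
    refine lp.ext_continuousLinearMap (𝕜 := ℂ) (by simp) fun x => ?_
    ext1
    simp [star_lpPullback_single, lpPullback_single]
  sum_eq_one := by
    classical
    refine lp.ext_continuousLinearMap (𝕜 := ℂ) (by simp) fun x => ?_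
    ext1
    obtain ⟨⟨i, y⟩, rfl⟩ := hφ.2 x
    have h : ∀ k, (star (lpPullback (φ k) (hφ' k)) * lpPullback (φ k) (hφ' k))
        (lp.single 2 (φ i y) (1 : ℂ)) = if k = i then lp.single 2 (φ i y) (1 : ℂ) else 0 := by
      intro k
      rw [mul_apply_eq_comp]
      split_ifs with hk
      · subst hk
        rw [lpPullback_single, star_lpPullback_single]
      · rw [lpPullback_single_of_notMem, map_zero]
        rintro ⟨z, hz⟩
        exact hk (congrArg Prod.fst (@hφ.1 (k, z) (i, y) hz))
    simp only [star_star]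
    simp [h]

end Pullback

/-! ### A concrete representation: `O_id` is nonzero -/

namespace RankTwoGraph

/-- Induction on words, adding one letter on the left. -/
theorem word_induction {m n : ℕ} {θ : Equiv.Perm (Fin m × Fin n)} {p : Graph θ → Prop}
    (one : p 1) (mul : ∀ u v, p u → p v → p (u * v)) (he : ∀ i, p (e θ i)) (hf : ∀ j, p (f θ j))
    (u : Graph θ) : p u := by
  have hu : u ∈ Submonoid.closure (Set.range (PresentedMonoid.of (CommRel θ))) := by simp
  induction hu using Submonoid.closure_induction with
  | mem x hx =>
    obtain ⟨i | j, rfl⟩ := hx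
    · exact he i
    · exact hf j
  | one => exact one
  | mul x y _ _ hx hy => exact mul x y hx hy

theorem e_mul_f {m n : ℕ} (i : Fin m) (j : Fin n) : e 1 i * f 1 j = f 1 j * e 1 i :=
  PresentedMonoid.mk_eq_mk_of_rel (CommRel.comm i j)

/-- Two commuting Cuntz families define a defect free family. -/
theorem exists_isDefectFree {m n : ℕ} {B : Type*} [CStarAlgebra B] {S : Fin m → B} {T : Fin n → B}
    (hS : IsCuntzFamily S) (hT : IsCuntzFamily T) (hST : ∀ i j, S i * T j = T j * S i) :
    ∃ t : Graph (1 : Equiv.Perm (Fin m × Fin n)) →* B, IsDefectFree t := by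
  let t : Graph (1 : Equiv.Perm (Fin m × Fin n)) →* B :=
    PresentedMonoid.lift (Sum.elim S T) (by rintro _ _ ⟨i, j⟩; simpa using hST i j)
  refine ⟨t, ⟨?_, hS.sum_eq_one, hT.sum_eq_one⟩⟩
  refine word_induction (by simp) (fun u v hu hv => ?_) hS.isometry hT.isometry
  rw [map_mul, star_mul, mul_assoc, ← mul_assoc (star (t u)), hu, one_mul, hv]

/-- Division with remainder partitions `ℕ` into residue classes, each a copy of `ℕ`; this supplies
the maps for the representation on `ℓ²(ℕ × ℕ)`. -/
theorem bijective_residue {m : ℕ} (hm : m ≠ 0) :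
    Function.Bijective fun p : Fin m × ℕ => m * p.2 + p.1 := by
  have hm' : 0 < m := Nat.pos_of_ne_zero hm
  constructor
  · rintro ⟨i, x⟩ ⟨j, y⟩ h
    have h1 := congrArg (· % m) h
    have h2 := congrArg (· / m) h
    simp only [Nat.mul_add_mod, Nat.mod_eq_of_lt i.2, Nat.mod_eq_of_lt j.2] at h1
    simp only [Nat.mul_add_div hm', Nat.div_eq_of_lt i.2, Nat.div_eq_of_lt j.2, add_zero] at h2
    exact Prod.ext (Fin.ext h1) h2
  · intro x
    exact ⟨(⟨x % m, Nat.mod_lt _ hm'⟩, x / m), Nat.div_add_mod x m⟩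

/-- The algebra `O_id` is nonzero. -/
theorem nontrivial_graphCStar {m n : ℕ} (hm : m ≠ 0) (hn : n ≠ 0) :
    Nontrivial (GraphCStar (1 : Equiv.Perm (Fin m × Fin n))) := by
  have bm := bijective_residue hm
  have bn := bijective_residue hn
  let φ : Fin m → ℕ × ℕ → ℕ × ℕ := fun i x => (m * x.1 + i, x.2)
  let ψ : Fin n → ℕ × ℕ → ℕ × ℕ := fun j x => (x.1, n * x.2 + j)
  have hφ : Function.Bijective fun p : Fin m × ℕ × ℕ => φ p.1 p.2 := by
    constructor
    · rintro ⟨i, x, y⟩ ⟨i', x', y'⟩ h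
      have h1 := @bm.1 (i, x) (i', x') (congrArg Prod.fst h)
      have h2 : y = y' := congrArg Prod.snd h
      simp_all
    · rintro ⟨x, y⟩
      obtain ⟨⟨i, z⟩, hz⟩ := bm.2 x
      exact ⟨(i, z, y), Prod.ext hz rfl⟩
  have hψ : Function.Bijective fun p : Fin n × ℕ × ℕ => ψ p.1 p.2 := by
    constructor
    · rintro ⟨i, x, y⟩ ⟨i', x', y'⟩ h
      have h1 := @bn.1 (i, y) (i', y') (congrArg Prod.snd h)
      have h2 : x = x' := congrArg Prod.fst h
      simp_all
    · rintro ⟨x, y⟩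
      obtain ⟨⟨i, z⟩, hz⟩ := bn.2 y
      exact ⟨(i, x, z), Prod.ext rfl hz⟩
  have hφ' : ∀ i, Function.Injective (φ i) := fun i x y h =>
    congrArg Prod.snd (@hφ.1 (i, x) (i, y) h)
  have hψ' : ∀ i, Function.Injective (ψ i) := fun i x y h =>
    congrArg Prod.snd (@hψ.1 (i, x) (i, y) h)
  obtain ⟨t, ht⟩ := exists_isDefectFree (isCuntzFamily_star_lpPullback φ hφ hφ')
    -- The two families act on different coordinates of `ℕ × ℕ`, hence commute.
    (isCuntzFamily_star_lpPullback ψ hψ hψ') fun i j => by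
      rw [← star_mul, ← star_mul]
      rfl
  have : Nontrivial (lp (fun _ : ℕ × ℕ => ℂ) 2) :=
    ⟨lp.single 2 0 1, 0, fun h => by simpa using congrArg (fun ξ => ξ 0) h⟩
  exact (lift t ht).toAlgHom.toRingHom.domain_nontrivial

end RankTwoGraph

/-! ### The limit functional, its invariance, and traces -/

section LimitState

variable {ι A : Type*} [Fintype ι] [CStarAlgebra A] {S : ι → A}

/-- The elements commuting with a Cuntz family commute with the adjoints. -/
theorem IsCuntzFamily.star_mul_comm (hS : IsCuntzFamily S) {a : A} (h : ∀ i, S i * a = a * S i)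
    (i : ι) : star (S i) * a = a * star (S i) := by
  classical
  have h1 : ∀ k, star (S i) * a * (S k * star (S k)) = if i = k then a * star (S k) else 0 := by
    intro k
    calc star (S i) * a * (S k * star (S k)) = star (S i) * (a * S k) * star (S k) := by
          simp only [mul_assoc]
      _ = star (S i) * S k * a * star (S k) := by rw [← h]; simp only [mul_assoc]
      _ = _ := by rw [hS.star_mul_eq_ite]; split_ifs <;> simp
  rw [← mul_one (star (S i) * a), ← hS.sum_eq_one, Finset.mul_sum]
  simp only [h1, Finset.sum_ite_eq, Finset.mem_univ, if_true]

/-- The limits of the averages define a continuous linear functional. -/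
theorem IsCuntzFamily.exists_limit [Nontrivial A] (hS : IsCuntzFamily S)
    (h : ∀ x : A, ∃ c, AveragesTo S x c) : ∃ ω : A →L[ℂ] ℂ, ∀ x, AveragesTo S x (ω x) := by
  choose c hc using h
  let L : A →ₗ[ℂ] ℂ :=
    { toFun := c
      map_add' := fun x y => (hc _).unique ((hc x).add (hc y))
      map_smul' := fun r x => (hc _).unique ((hc x).smul r) }
  exact ⟨L.mkContinuous 1 fun x => by rw [one_mul]; exact (hc x).norm_le hS, hc⟩

variable {ω : A →L[ℂ] ℂ}

theorem isState_of_averagesTo [Nontrivial A] [Nonempty ι] (hS : IsCuntzFamily S)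
    (hω : ∀ x, AveragesTo S x (ω x)) : RankTwoGraph.IsState ω where
  nonneg _ := (hω _).nonneg
  map_one := (hω 1).unique hS.averagesTo_one

/-- The limit functional is invariant under the unital maps which commute with the averages. -/
theorem apply_eq_of_commute [Nontrivial A] (hω : ∀ x, AveragesTo S x (ω x)) {T : A →L[ℂ] A}
    (hT : T 1 = 1) (h : ∀ x, cuntzAverage S (T x) = T (cuntzAverage S x)) (x : A) :
    ω (T x) = ω x := by
  have hk : ∀ k x, (cuntzAverage S ^ k) (T x) = T ((cuntzAverage S ^ k) x) := fun k => by
    induction k with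
    | zero => simp
    | succ k ih => intro x; rw [pow_succ, mul_apply_eq_comp, h, ih, mul_apply_eq_comp]
  refine (hω (T x)).unique ?_
  have h1 := (T.continuous.tendsto _).comp (hω x)
  rw [Algebra.algebraMap_eq_smul_one, map_smul, hT, ← Algebra.algebraMap_eq_smul_one] at h1
  exact h1.congr fun k => (hk k x).symm

/-- The phase from `S i` cancels the conjugate phase from its adjoint. -/
theorem cuntzAverage_map_of_smul {w : ℂ} (hw : star w * w = 1) (γ : A →⋆ₐ[ℂ] A)
    (h : ∀ i, γ (S i) = w • S i) (x : A) : cuntzAverage S (γ x) = γ (cuntzAverage S x) := by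
  simp only [cuntzAverage_apply, map_smul, map_sum, map_mul, map_star, h, star_smul,
    smul_mul_assoc, mul_smul_comm, smul_smul, hw, mul_comm w, one_smul]

theorem IsCuntzFamily.endomorphism_map_of_smul (hS : IsCuntzFamily S) {w : ℂ}
    (hw : star w * w = 1) (γ : A →⋆ₐ[ℂ] A) (h : ∀ i, γ (S i) = w • S i) (x : A) :
    hS.endomorphism (γ x) = γ (hS.endomorphism x) := by
  simp only [hS.endomorphism_apply, map_sum, map_mul, map_star, h, star_smul,
    smul_mul_assoc, mul_smul_comm, smul_smul, hw, one_smul]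

/-- A trace on a C*-subalgebra containing the `S p S q*` takes the same value at `x` and at the
image under the endomorphism of the average of `x`. -/
theorem IsCuntzFamily.trace_endomorphism_cuntzAverage [Nonempty ι] (hS : IsCuntzFamily S)
    {B : StarSubalgebra ℂ A} (hB : ∀ p q, S p * star (S q) ∈ B)
    (hα : ∀ x ∈ B, hS.endomorphism x ∈ B) (hΨ : ∀ x ∈ B, cuntzAverage S x ∈ B) (τ : B →ₗ[ℂ] ℂ)
    (hτ : ∀ a b, τ (a * b) = τ (b * a)) (x : B) :
    τ ⟨hS.endomorphism (cuntzAverage S x), hα _ (hΨ _ x.2)⟩ = τ x := by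
  let v : ι → ι → B := fun p q => ⟨S p * star (S q), hB p q⟩
  -- The `S p` need not lie in `B`, so the trace is moved around the `v p q = S_p S_q*` instead;
  -- below, `∑ v* v = |ι| • 1` cancels the normalization.
  have h1 : (⟨hS.endomorphism (cuntzAverage S x), hα _ (hΨ _ x.2)⟩ : B) =
      (Fintype.card ι : ℂ)⁻¹ • ∑ p, ∑ q, v p q * (x * star (v p q)) := by
    apply Subtype.ext
    change hS.endomorphism _ = _
    rw [hS.endomorphism_apply]
    push_cast
    simp only [cuntzAverage_apply, mul_smul_comm, smul_mul_assoc, ← Finset.smul_sum,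
      Finset.mul_sum, Finset.sum_mul]
    refine congrArg _ (Finset.sum_congr rfl fun p _ => Finset.sum_congr rfl fun q _ => ?_)
    change _ = S p * star (S q) * (x * star (S p * star (S q)))
    simp only [star_mul, star_star, mul_assoc]
  have h2 : ∑ p, ∑ q, star (v p q) * v p q = (Fintype.card ι : ℂ) • (1 : B) := by
    have h3 : ∀ p q, star (v p q) * v p q =
        ⟨S q * star (S q), hB q q⟩ := fun p q => by
      apply Subtype.ext
      change star (S p * star (S q)) * (S p * star (S q)) = _
      rw [star_mul, star_star, mul_assoc, ← mul_assoc (star (S p)), hS.isometry, one_mul]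
    have h4 : ∑ q, (⟨S q * star (S q), hB q q⟩ : B) = 1 := by
      apply Subtype.ext
      push_cast
      exact hS.sum_eq_one
    simp only [h3, h4, Finset.sum_const, Finset.card_univ, Nat.cast_smul_eq_nsmul]
  rw [h1, map_smul, map_sum]
  simp only [map_sum]
  have h5 : ∀ p q, τ (v p q * (x * star (v p q))) = τ (x * (star (v p q) * v p q)) := fun p q => by
    rw [hτ, mul_assoc]
  simp only [h5]
  simp only [← map_sum, ← Finset.mul_sum]
  rw [h2, mul_smul_comm, mul_one, map_smul, smul_smul, inv_mul_cancel₀, one_smul]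
  exact_mod_cast Fintype.card_ne_zero

/-- A continuous unital trace on a C*-subalgebra containing the `S p S q*` is given by the limits of
the averages. -/
theorem IsCuntzFamily.trace_eq [Nontrivial A] [Nonempty ι] (hS : IsCuntzFamily S)
    {B : StarSubalgebra ℂ A} (hB : ∀ p q, S p * star (S q) ∈ B)
    (hα : ∀ x ∈ B, hS.endomorphism x ∈ B) (hΨ : ∀ x ∈ B, cuntzAverage S x ∈ B) (τ : B →L[ℂ] ℂ)
    (hτ : ∀ a b, τ (a * b) = τ (b * a)) (hτ1 : τ 1 = 1) {x : B} {c : ℂ}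
    (hx : AveragesTo S (x : A) c) : τ x = c := by
  have hαk : ∀ k, ∀ x ∈ B, hS.endomorphism^[k] x ∈ B := fun k => by
    induction k with
    | zero => exact fun x hx => hx
    | succ k ih => intro x hx; rw [Function.iterate_succ_apply]; exact ih _ (hα x hx)
  have hΨk : ∀ k, ∀ x ∈ B, (cuntzAverage S ^ k) x ∈ B := fun k => by
    induction k with
    | zero => exact fun x hx => by simpa using hx
    | succ k ih => intro x hx; rw [pow_succ, mul_apply_eq_comp]; exact ih _ (hΨ x hx)
  -- The trace varies in the induction: the step applies the hypothesis to `τ ∘ α`, again a trace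
  -- because the endomorphism `α` is multiplicative. Only linear functionals are considered, so
  -- continuity need not be carried along.
  have key : ∀ k (τ : B →ₗ[ℂ] ℂ), (∀ a b, τ (a * b) = τ (b * a)) → ∀ x : B,
      τ ⟨hS.endomorphism^[k] ((cuntzAverage S ^ k) x), hαk k _ (hΨk k _ x.2)⟩ = τ x := fun k => by
    induction k with
    | zero => intro τ _ x; congr 1
    | succ k ih =>
      intro τ hτ x
      let α : B →ₗ[ℂ] B :=
        { toFun := fun y => ⟨hS.endomorphism y, hα _ y.2⟩
          map_add' := fun y z => Subtype.ext (map_add hS.endomorphism (y : A) z)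
          map_smul' := fun r y => Subtype.ext (map_smul hS.endomorphism r (y : A)) }
      have h1 := ih (τ.comp α) (fun a b => by
        have h : ∀ a b, α (a * b) = α a * α b := fun a b =>
          Subtype.ext (map_mul hS.endomorphism (a : A) b)
        rw [LinearMap.comp_apply, LinearMap.comp_apply, h, h, hτ]) ⟨_, hΨ _ x.2⟩
      have h2 := hS.trace_endomorphism_cuntzAverage hB hα hΨ τ hτ x
      rw [← h2]
      refine Eq.trans ?_ h1
      rw [LinearMap.comp_apply]
      congr 1
      apply Subtype.ext
      change hS.endomorphism^[k + 1] _ = hS.endomorphism (hS.endomorphism^[k] _)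
      rw [Function.iterate_succ_apply', pow_succ, mul_apply_eq_comp]
  have hαc : ∀ k, hS.endomorphism^[k] (algebraMap ℂ A c) = algebraMap ℂ A c := fun k =>
    Function.iterate_fixed (AlgHomClass.commutes hS.endomorphism c) k
  -- The endomorphism is contractive and fixes scalars, so its iterates cannot spoil the convergence
  -- of the averages to `c`.
  have hnorm : ∀ k (y : A), ‖hS.endomorphism^[k] y - algebraMap ℂ A c‖ ≤
      ‖y - algebraMap ℂ A c‖ := fun k y => by
    induction k with
    | zero => exact le_rfl
    | succ k ih =>
      refine le_trans ?_ ih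
      rw [Function.iterate_succ_apply']
      nth_rw 1 [← AlgHomClass.commutes hS.endomorphism c, ← map_sub]
      exact NonUnitalStarAlgHom.norm_apply_le _ _
  have hlim : Filter.Tendsto (fun k => (⟨hS.endomorphism^[k] ((cuntzAverage S ^ k) x),
      hαk k _ (hΨk k _ x.2)⟩ : B)) Filter.atTop (nhds (algebraMap ℂ B c)) := by
    rw [tendsto_subtype_rng, tendsto_iff_norm_sub_tendsto_zero]
    exact squeeze_zero (fun k => norm_nonneg _) (fun k => hnorm k _)
      (tendsto_iff_norm_sub_tendsto_zero.1 hx)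
  have h1 := (τ.continuous.tendsto _).comp hlim
  rw [Algebra.algebraMap_eq_smul_one, map_smul, hτ1, smul_eq_mul, mul_one] at h1
  exact tendsto_nhds_unique (tendsto_const_nhds.congr fun k => (key k τ hτ x).symm) h1

end LimitState

/-! ### The KMS relation for eigenvectors -/

namespace RankTwoGraph

section KMS

variable {A : Type*} [CStarAlgebra A] {α : ℝ → A ≃⋆ₐ[ℂ] A} {ω : A →L[ℂ] ℂ}

/-- `b` is an eigenvector of the one-parameter group: `α_t(b) = e^{itl} b`. -/
def IsEigenvector (α : ℝ → A ≃⋆ₐ[ℂ] A) (b : A) (l : ℝ) : Prop :=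
  ∀ t : ℝ, α t b = Complex.exp (Complex.I * t * l) • b

theorem IsEigenvector.mul {b c : A} {l r : ℝ} (hb : IsEigenvector α b l)
    (hc : IsEigenvector α c r) : IsEigenvector α (b * c) (l + r) := fun t => by
  rw [map_mul, hb t, hc t, smul_mul_smul_comm, ← Complex.exp_add]
  push_cast
  ring_nf

theorem IsEigenvector.star {b : A} {l : ℝ} (hb : IsEigenvector α b l) :
    IsEigenvector α (star b) (-l) := fun t => by
  rw [map_star, hb t, star_smul, Complex.star_def, ← Complex.exp_conj]
  simp

theorem isEigenvector_one : IsEigenvector α 1 0 := fun t => by simp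

theorem IsEigenvector.isEntireOrbit {b : A} {l : ℝ} (hb : IsEigenvector α b l) :
    IsEntireOrbit α b fun z => Complex.exp (Complex.I * z * l) • b where
  differentiable := by fun_prop
  apply_ofReal t := (hb t).symm

/-- Entire functions which agree on the real axis are equal. -/
theorem eq_of_eqOn_real {g h : ℂ → ℂ} (hg : Differentiable ℂ g) (hh : Differentiable ℂ h)
    (heq : ∀ t : ℝ, g t = h t) : g = h := by
  refine AnalyticOnNhd.eq_of_frequently_eq (𝕜 := ℂ) (z₀ := 0)
    (fun z _ => hg.analyticAt z) (fun z _ => hh.analyticAt z) ?_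
  -- Nonzero real points accumulate at `0`, so the identity theorem applies there.
  have ht : Filter.Tendsto (fun t : ℝ => (t : ℂ)) (nhdsWithin 0 {0}ᶜ) (nhdsWithin 0 {0}ᶜ) := by
    refine tendsto_nhdsWithin_iff.2 ⟨?_, ?_⟩
    · have := Complex.continuous_ofReal.tendsto 0
      rw [Complex.ofReal_zero] at this
      exact this.mono_left nhdsWithin_le_nhds
    · filter_upwards [self_mem_nhdsWithin] with t ht
      simpa using ht
  exact ht.frequently (Filter.Frequently.of_forall heq)

/-- `b` is an eigenvector with eigenvalue `l` satisfying the KMS relation `ω(ab) = e^{-l} ω(ba)`. -/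
structure IsKMSEigenvector (α : ℝ → A ≃⋆ₐ[ℂ] A) (ω : A →L[ℂ] ℂ) (b : A) (l : ℝ) : Prop where
  eigenvector : IsEigenvector α b l
  kms : ∀ a, ω (a * b) = Complex.exp (-l) * ω (b * a)

theorem isKMSEigenvector_one : IsKMSEigenvector α ω 1 0 :=
  ⟨isEigenvector_one, by simp⟩

theorem IsKMSEigenvector.mul {b c : A} {l r : ℝ} (hb : IsKMSEigenvector α ω b l)
    (hc : IsKMSEigenvector α ω c r) : IsKMSEigenvector α ω (b * c) (l + r) := by
  refine ⟨hb.eigenvector.mul hc.eigenvector, fun a => ?_⟩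
  rw [← mul_assoc, hc.kms, ← mul_assoc, hb.kms, mul_assoc, ← mul_assoc, ← Complex.exp_add]
  push_cast
  ring_nf

/-- Conjugate the relation at `a*`; since `l` is real, the exponential is unchanged and only changes
sides. -/
theorem IsKMSEigenvector.star (hω : ∀ x, ω (star x) = star (ω x)) {b : A} {l : ℝ}
    (hb : IsKMSEigenvector α ω b l) : IsKMSEigenvector α ω (star b) (-l) := by
  refine ⟨hb.eigenvector.star, fun a => ?_⟩
  have h := congrArg Star.star (hb.kms (Star.star a))
  rw [← hω, star_mul', ← hω, star_mul, star_mul, star_star] at h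
  rw [h, Complex.star_def, ← Complex.exp_conj, ← mul_assoc, ← Complex.exp_add]
  simp

/-- For real `t`, `b α_t(a) = α_t(α_{-t}(b) a) = e^{-itl} α_t(ba)`, so by invariance `ω(b F(t)) =
e^{-itl} ω(ba)`. Both sides are entire in `t`; at `-i` the right side is `e^{-l} ω(ba) = ω(ab)`. -/
theorem IsKMSEigenvector.apply_mul {b : A} {l : ℝ} (hb : IsKMSEigenvector α ω b l)
    (hω : ∀ t x, ω (α t x) = ω x) {a : A} {F : ℂ → A} (hF : IsEntireOrbit α a F) :
    ω (a * b) = ω (b * F (Complex.I * (-1 : ℝ))) := by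
  have h : (fun z => ω (b * F z)) = fun z => Complex.exp (-(Complex.I * z * l)) * ω (b * a) := by
    refine eq_of_eqOn_real ?_ (by fun_prop) fun t => ?_
    · have := hF.differentiable
      exact ω.differentiable.comp ((differentiable_const b).mul this)
    · rw [hF.apply_ofReal]
      have h1 : b * α t a = α t ((Complex.exp (-(Complex.I * t * l)) • b) * a) := by
        rw [map_mul, map_smul, hb.eigenvector t, smul_smul, ← Complex.exp_add]
        simp
      rw [h1, hω, smul_mul_assoc, map_smul, smul_eq_mul]
  have h2 := congrFun h (Complex.I * (-1 : ℝ))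
  change ω (b * F (Complex.I * (-1 : ℝ))) = _ at h2
  rw [h2, hb.kms]
  congr 2
  push_cast
  linear_combination -(l : ℂ) * Complex.I_mul_I

end KMS

/-! ### The limit state on `O_id`, and uniqueness of the KMS state and the trace -/

section IdentityGraph

variable {m n : ℕ}

/-- The algebra `O_id`. -/
abbrev IdGraphCStar (m n : ℕ) : Type 1 :=
  GraphCStar (1 : Equiv.Perm (Fin m × Fin n))

/-- The multiplicative closure of the isometries `s_u` and their adjoints. -/
noncomputable def monomials {m n : ℕ} (θ : Equiv.Perm (Fin m × Fin n)) : Submonoid (GraphCStar θ) :=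
  Submonoid.closure (Set.range (s θ) ∪ star (Set.range (s θ)))

theorem star_s_mem_monomials (θ : Equiv.Perm (Fin m × Fin n)) (u : Graph θ) :
    star (s θ u) ∈ monomials θ :=
  Submonoid.subset_closure (Or.inr (Set.star_mem_star.2 ⟨u, rfl⟩))

/-- The span of the monomials is dense. -/
theorem monomials_induction {θ : Equiv.Perm (Fin m × Fin n)} {p : GraphCStar θ → Prop}
    (hclosed : IsClosed {x | p x}) (mem : ∀ x ∈ monomials θ, p x) (zero : p 0)
    (add : ∀ x y, p x → p y → p (x + y)) (smul : ∀ (r : ℂ) x, p x → p (r • x))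
    (x : GraphCStar θ) : p x := by
  refine closure_minimal (fun y hy => ?_) hclosed (adjoin_dense θ x)
  rw [SetLike.mem_coe, ← StarSubalgebra.mem_toSubalgebra, StarAlgebra.adjoin_toSubalgebra,
    ← Subalgebra.mem_toSubmodule, Algebra.adjoin_eq_span] at hy
  change p y
  induction hy using Submodule.span_induction with
  | mem x hx => exact mem x hx
  | zero => exact zero
  | add x y _ _ hx hy => exact add x y hx hy
  | smul r x _ hx => exact smul r x hx

theorem isCuntzFamily_e (θ : Equiv.Perm (Fin m × Fin n)) : IsCuntzFamily fun i => s θ (e θ i) :=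
  ⟨fun _ => (s_defectFree θ).isometry _, (s_defectFree θ).sum_e⟩

theorem isCuntzFamily_f (θ : Equiv.Perm (Fin m × Fin n)) : IsCuntzFamily fun j => s θ (f θ j) :=
  ⟨fun _ => (s_defectFree θ).isometry _, (s_defectFree θ).sum_f⟩

/-- The family of the isometries `s_{e_i f_j}`. -/
noncomputable def efFamily {m n : ℕ} (θ : Equiv.Perm (Fin m × Fin n)) (p : Fin m × Fin n) :
    GraphCStar θ :=
  s θ (e θ p.1) * s θ (f θ p.2)

theorem isCuntzFamily_ef (θ : Equiv.Perm (Fin m × Fin n)) : IsCuntzFamily (efFamily θ) :=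
  (isCuntzFamily_e θ).mul (isCuntzFamily_f θ)

theorem efFamily_eq (θ : Equiv.Perm (Fin m × Fin n)) (p : Fin m × Fin n) :
    efFamily θ p = s θ (e θ p.1 * f θ p.2) :=
  (map_mul (s θ) _ _).symm

theorem s_e_mul_s_f (i : Fin m) (j : Fin n) :
    s 1 (e 1 i) * s 1 (f 1 j) = s 1 (f 1 j) * s 1 (e 1 i) := by
  rw [← map_mul, ← map_mul, e_mul_f]

theorem star_mem_closure_union_star {A : Type*} [Monoid A] [StarMul A] {S : Set A} {x : A}
    (hx : x ∈ Submonoid.closure (S ∪ star S)) : star x ∈ Submonoid.closure (S ∪ star S) := by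
  induction hx using Submonoid.closure_induction with
  | mem x hx =>
    refine Submonoid.subset_closure ?_
    rcases hx with h | h
    · exact Or.inr (Set.star_mem_star.2 h)
    · exact Or.inl h
  | one => rw [star_one]; exact one_mem _
  | mul x y _ _ hx hy => rw [star_mul]; exact mul_mem hy hx

/-- The averages over the `s_{e_i f_j}` converge to scalars on all of `O_id`. -/
theorem exists_averagesTo_ef (hm : 2 ≤ m) (hn : 2 ≤ n) (x : IdGraphCStar m n) :
    ∃ c, AveragesTo (efFamily 1) x c := by
  have hE := isCuntzFamily_e (1 : Equiv.Perm (Fin m × Fin n))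
  have hF := isCuntzFamily_f (1 : Equiv.Perm (Fin m × Fin n))
  set E : Fin m → IdGraphCStar m n := fun i => s 1 (e 1 i) with hEdef
  set F : Fin n → IdGraphCStar m n := fun j => s 1 (f 1 j) with hFdef
  have hEF : ∀ i j, E i * F j = F j * E i := s_e_mul_s_f
  -- `B` is the commutant of the `f` isometries and their adjoints, and `C` the commutant of `B`.
  -- They commute by construction, `B` contains the `e` isometries and `C` the `f` isometries.
  let B : StarSubalgebra ℂ (IdGraphCStar m n) := StarSubalgebra.centralizer ℂ (Set.range F)
  let C : StarSubalgebra ℂ (IdGraphCStar m n) := StarSubalgebra.centralizer ℂ (B : Set (IdGraphCStar m n))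
  have hBC : ∀ b ∈ B, ∀ c ∈ C, b * c = c * b := fun b hb c hc =>
    ((StarSubalgebra.mem_centralizer_iff ℂ).1 hc b hb).1
  have hEB : ∀ i, E i ∈ B := fun i => by
    rw [StarSubalgebra.mem_centralizer_iff]
    rintro _ ⟨j, rfl⟩
    exact ⟨(hEF i j).symm, hF.star_mul_comm (fun j => (hEF i j).symm) j⟩
  have hFC : ∀ j, F j ∈ C := fun j => by
    rw [StarSubalgebra.mem_centralizer_iff]
    intro b hb
    exact ⟨((StarSubalgebra.mem_centralizer_iff ℂ).1 hb _ ⟨j, rfl⟩).1.symm,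
      ((StarSubalgebra.mem_centralizer_iff ℂ).1 (star_mem hb) _ ⟨j, rfl⟩).1.symm⟩
  let P := Submonoid.closure (Set.range E ∪ star (Set.range E))
  let Q := Submonoid.closure (Set.range F ∪ star (Set.range F))
  have hPB : ∀ x ∈ P, x ∈ B := fun x hx => by
    refine (Submonoid.closure_le (S := B.toSubmonoid)).2 ?_ hx
    rintro y (⟨i, rfl⟩ | ⟨i, hi⟩)
    · exact hEB i
    · have := star_mem (hEB i)
      rw [hi, star_star] at this
      exact this
  have hQC : ∀ x ∈ Q, x ∈ C := fun x hx => by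
    refine (Submonoid.closure_le (S := C.toSubmonoid)).2 ?_ hx
    rintro y (⟨i, rfl⟩ | ⟨i, hi⟩)
    · exact hFC i
    · have := star_mem (hFC i)
      rw [hi, star_star] at this
      exact this
  -- As `P` and `Q` commute, the products `ab` are closed under multiplication; hence every monomial
  -- separates into an `e` part and an `f` part.
  have hmul : ∀ x y : IdGraphCStar m n, (∃ a ∈ P, ∃ b ∈ Q, x = a * b) → (∃ a ∈ P, ∃ b ∈ Q, y = a * b) →
      ∃ a ∈ P, ∃ b ∈ Q, x * y = a * b := by
    rintro _ _ ⟨a, ha, b, hb, rfl⟩ ⟨a', ha', b', hb', rfl⟩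
    refine ⟨a * a', mul_mem ha ha', b * b', mul_mem hb hb', ?_⟩
    calc a * b * (a' * b') = a * (b * a') * b' := by simp only [mul_assoc]
      _ = a * (a' * b) * b' := by rw [hBC a' (hPB _ ha') b (hQC _ hb)]
      _ = _ := by simp only [mul_assoc]
  have hs : ∀ u, ∃ a ∈ P, ∃ b ∈ Q, s 1 u = a * b := by
    refine word_induction ⟨1, one_mem _, 1, one_mem _, by simp⟩ (fun u v hu hv => ?_)
      (fun i => ⟨E i, Submonoid.subset_closure (Or.inl ⟨i, rfl⟩), 1, one_mem _, by simp [E]⟩)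
      (fun j => ⟨1, one_mem _, F j, Submonoid.subset_closure (Or.inl ⟨j, rfl⟩), by simp [F]⟩)
    rw [map_mul]
    exact hmul _ _ hu hv
  have hmon : ∀ x ∈ monomials (1 : Equiv.Perm (Fin m × Fin n)), ∃ a ∈ P, ∃ b ∈ Q, x = a * b := by
    intro x hx
    induction hx using Submonoid.closure_induction with
    | mem x hx =>
      rcases hx with ⟨u, rfl⟩ | ⟨u, hu⟩
      · exact hs u
      · obtain ⟨a, ha, b, hb, hab⟩ := hs u
        refine ⟨star a, star_mem_closure_union_star ha, star b, star_mem_closure_union_star hb, ?_⟩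
        rw [← star_mul, ← hBC a (hPB _ ha) b (hQC _ hb), ← hab, hu, star_star]
    | one => exact ⟨1, one_mem _, 1, one_mem _, by simp⟩
    | mul x y _ _ hx hy => exact hmul x y hx hy
  refine monomials_induction (p := fun x => ∃ c, AveragesTo (efFamily 1) x c)
    (isCuntzFamily_ef 1).isClosed_averagesTo (fun x hx => ?_) ⟨0, averagesTo_zero _⟩
    (fun x y ⟨c, hc⟩ ⟨d, hd⟩ => ⟨_, hc.add hd⟩) (fun r x ⟨c, hc⟩ => ⟨_, hc.smul r⟩) x
  obtain ⟨a, ha, b, hb, rfl⟩ := hmon x hx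
  obtain ⟨c, hc⟩ := hE.exists_averagesTo (by rw [Fintype.card_fin]; omega) ha
  obtain ⟨d, hd⟩ := hF.exists_averagesTo (by rw [Fintype.card_fin]; omega) hb
  exact ⟨_, hc.mul hBC hEB hFC (hPB a ha) (hQC b hb) hd⟩

theorem gauge_efFamily (z : Circle × Circle) (p : Fin m × Fin n) :
    gauge 1 z (efFamily 1 p) = ((z.1 : ℂ) * z.2) • efFamily 1 p := by
  rw [efFamily_eq, gauge_s, weight_mul]
  congr 1
  have he : degree (1 : Equiv.Perm (Fin m × Fin n)) (e 1 p.1) = Multiplicative.ofAdd (1, 0) := rfl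
  have hf : degree (1 : Equiv.Perm (Fin m × Fin n)) (f 1 p.2) = Multiplicative.ofAdd (0, 1) := rfl
  simp [weight, he, hf]

theorem star_mul_self_circle (z : Circle × Circle) :
    star ((z.1 : ℂ) * z.2) * ((z.1 : ℂ) * z.2) = 1 := by
  rw [Complex.star_def, Complex.conj_mul', norm_mul, Circle.norm_coe, Circle.norm_coe]
  simp

theorem isEigenvector_e (i : Fin m) :
    IsEigenvector (sigma (1 : Equiv.Perm (Fin m × Fin n))) (s 1 (e 1 i)) (-Real.log m) := by
  intro t
  have he : degree (1 : Equiv.Perm (Fin m × Fin n)) (e 1 i) = Multiplicative.ofAdd (1, 0) := rfl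
  rw [sigma, gauge_s, weight, he]
  simp only [toAdd_ofAdd, pow_one, pow_zero, mul_one, Circle.coe_exp]
  congr 2
  push_cast
  ring

theorem isEigenvector_f (j : Fin n) :
    IsEigenvector (sigma (1 : Equiv.Perm (Fin m × Fin n))) (s 1 (f 1 j)) (-Real.log n) := by
  intro t
  have hf : degree (1 : Equiv.Perm (Fin m × Fin n)) (f 1 j) = Multiplicative.ofAdd (0, 1) := rfl
  rw [sigma, gauge_s, weight, hf]
  simp only [toAdd_ofAdd, pow_one, pow_zero, one_mul, Circle.coe_exp]
  congr 2
  push_cast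
  ring

/-- Averaging `S i * a` gives `a * S i` divided by the size of the family, so invariance under the
average is already a KMS relation. -/
theorem _root_.IsCuntzFamily.apply_mul_eq {ι A : Type*} [Fintype ι] [Nonempty ι] [CStarAlgebra A]
    {S : ι → A} (hS : IsCuntzFamily S) {ω : A →L[ℂ] ℂ}
    (hω : ∀ x, ω (cuntzAverage S x) = ω x) (i : ι) (a : A) :
    ω (a * S i) = Fintype.card ι * ω (S i * a) := by
  rw [← hω (S i * a), hS.cuntzAverage_cons, map_smul, smul_eq_mul, ← mul_assoc, mul_inv_cancel₀,
    one_mul]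
  exact_mod_cast Fintype.card_ne_zero

variable {ω : IdGraphCStar m n →L[ℂ] ℂ}

/-- The average over the `s_{e_i f_j}` is the composite of the separate `e` and `f` averages. These
commute, so each commutes with the composite and preserves its limit functional. -/
theorem apply_cuntzAverage_e [Nontrivial (IdGraphCStar m n)] (hm : m ≠ 0)
    (hω : ∀ x, AveragesTo (efFamily 1) x (ω x)) (x : IdGraphCStar m n) :
    ω (cuntzAverage (fun i => s 1 (e 1 i)) x) = ω x := by
  have : NeZero m := ⟨hm⟩
  refine apply_eq_of_commute hω (isCuntzFamily_e 1).cuntzAverage_one (fun x => ?_) x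
  have h := commute_cuntzAverage (S := fun i : Fin m => s (1 : Equiv.Perm (Fin m × Fin n)) (e 1 i))
    (T := fun j : Fin n => s (1 : Equiv.Perm (Fin m × Fin n)) (f 1 j)) s_e_mul_s_f
  have h' := (h.mul_right (Commute.refl _)).symm
  rw [← cuntzAverage_mul] at h'
  exact congrArg (fun T : IdGraphCStar m n →L[ℂ] IdGraphCStar m n => T x) h'.eq

theorem apply_cuntzAverage_f [Nontrivial (IdGraphCStar m n)] (hn : n ≠ 0)
    (hω : ∀ x, AveragesTo (efFamily 1) x (ω x)) (x : IdGraphCStar m n) :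
    ω (cuntzAverage (fun j => s 1 (f 1 j)) x) = ω x := by
  have : NeZero n := ⟨hn⟩
  refine apply_eq_of_commute hω (isCuntzFamily_f 1).cuntzAverage_one (fun x => ?_) x
  have h := commute_cuntzAverage (S := fun i : Fin m => s (1 : Equiv.Perm (Fin m × Fin n)) (e 1 i))
    (T := fun j : Fin n => s (1 : Equiv.Perm (Fin m × Fin n)) (f 1 j)) s_e_mul_s_f
  have h' := ((Commute.refl _).mul_right h.symm).symm
  rw [← cuntzAverage_mul] at h'
  exact congrArg (fun T : IdGraphCStar m n →L[ℂ] IdGraphCStar m n => T x) h'.eq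

theorem apply_star [Nontrivial (IdGraphCStar m n)] (hω : ∀ x, AveragesTo (efFamily 1) x (ω x)) (x : IdGraphCStar m n) :
    ω (star x) = star (ω x) :=
  (hω _).unique (hω x).star

theorem apply_gauge [Nontrivial (IdGraphCStar m n)] (hω : ∀ x, AveragesTo (efFamily 1) x (ω x))
    (z : Circle × Circle) (x : IdGraphCStar m n) : ω (gauge 1 z x) = ω x := by
  let T : IdGraphCStar m n →L[ℂ] IdGraphCStar m n := ⟨(gaugeHom 1 z).toAlgHom.toLinearMap, continuous_hom _⟩
  exact apply_eq_of_commute hω (T := T) (map_one (gaugeHom 1 z)) (fun x =>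
    cuntzAverage_map_of_smul (star_mul_self_circle z) (gaugeHom 1 z) (gauge_efFamily z) x) x

/-- Every monomial is an eigenvector satisfying the KMS relation. -/
theorem exists_isKMSEigenvector [Nontrivial (IdGraphCStar m n)] (hm : m ≠ 0) (hn : n ≠ 0)
    (hω : ∀ x, AveragesTo (efFamily 1) x (ω x)) {b : IdGraphCStar m n} (hb : b ∈ monomials 1) :
    ∃ l, IsKMSEigenvector (sigma 1) ω b l := by
  have : NeZero m := ⟨hm⟩
  have : NeZero n := ⟨hn⟩
  have hs : ∀ u, ∃ l, IsKMSEigenvector (sigma 1) ω (s 1 u) l := by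
    refine word_induction ⟨0, ?_⟩ ?_ (fun i => ⟨_, isEigenvector_e i, fun a => ?_⟩)
      (fun j => ⟨_, isEigenvector_f j, fun a => ?_⟩)
    · rw [map_one]; exact isKMSEigenvector_one
    · rintro u v ⟨l, hl⟩ ⟨r, hr⟩
      rw [map_mul]
      exact ⟨_, hl.mul hr⟩
    · rw [(isCuntzFamily_e 1).apply_mul_eq (apply_cuntzAverage_e hm hω) i a, ← Complex.ofReal_neg,
        neg_neg, ← Complex.ofReal_exp, Real.exp_log (by positivity)]
      simp
    · rw [(isCuntzFamily_f 1).apply_mul_eq (apply_cuntzAverage_f hn hω) j a, ← Complex.ofReal_neg,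
        neg_neg, ← Complex.ofReal_exp, Real.exp_log (by positivity)]
      simp
  induction hb using Submonoid.closure_induction with
  | mem x hx =>
    rcases hx with ⟨u, rfl⟩ | ⟨u, hu⟩
    · exact hs u
    · obtain ⟨l, hl⟩ := hs u
      have h := hl.star (apply_star hω)
      rw [hu, star_star] at h
      exact ⟨_, h⟩
  | one => exact ⟨0, isKMSEigenvector_one⟩
  | mul x y _ _ hx hy =>
    obtain ⟨l, hl⟩ := hx
    obtain ⟨r, hr⟩ := hy
    exact ⟨_, hl.mul hr⟩

/-- The limit functional of the averages is a KMS state. -/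
theorem isKMSState_limit [Nontrivial (IdGraphCStar m n)] (hm : m ≠ 0) (hn : n ≠ 0)
    (hω : ∀ x, AveragesTo (efFamily 1) x (ω x)) : IsKMSState (sigma 1) ω := by
  have : NeZero m := ⟨hm⟩
  have : NeZero n := ⟨hn⟩
  refine ⟨isState_of_averagesTo (isCuntzFamily_ef 1) hω, fun a b F hF _ => ?_⟩
  -- For a fixed entire `a` both sides are continuous and linear in `b`, so it is enough to take `b`
  -- a monomial.
  refine monomials_induction
    (p := fun b => ω (a * b) = ω (b * F (Complex.I * (-1 : ℝ)))) ?_ ?_ ?_ ?_ ?_ b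
  · exact isClosed_eq (by fun_prop) (by fun_prop)
  · intro b hb
    obtain ⟨l, hl⟩ := exists_isKMSEigenvector hm hn hω hb
    exact hl.apply_mul (fun t x => apply_gauge hω _ x) hF
  · simp
  · intro x y hx hy
    rw [mul_add, add_mul, map_add, map_add, hx, hy]
  · intro r x hx
    rw [mul_smul_comm, smul_mul_assoc, map_smul, map_smul, hx]

/-- A KMS state is the limit functional of the averages. -/
theorem eq_of_isKMSState [Nontrivial (IdGraphCStar m n)] (hm : m ≠ 0) (hn : n ≠ 0)
    (hω : ∀ x, AveragesTo (efFamily 1) x (ω x)) {φ : IdGraphCStar m n →L[ℂ] ℂ} (hφ : IsKMSState (sigma 1) φ) :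
    φ = ω := by
  have hG := isCuntzFamily_ef (1 : Equiv.Perm (Fin m × Fin n))
  -- The eigenvalue of `σ_{-i}` on `s_{e_i f_j}` is `1 / (mn)`, exactly the normalization of the
  -- average.
  have hcard : Complex.exp (Complex.I * (Complex.I * (-1 : ℝ)) *
      ((-Real.log m + -Real.log n : ℝ) : ℂ)) = (Fintype.card (Fin m × Fin n) : ℂ)⁻¹ := by
    have h1 : Complex.I * (Complex.I * (-1 : ℝ)) * ((-Real.log m + -Real.log n : ℝ) : ℂ) =
        ((-(Real.log m + Real.log n) : ℝ) : ℂ) := by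
      push_cast
      linear_combination (Complex.log m + Complex.log n) * Complex.I_mul_I
    rw [h1, ← Complex.ofReal_exp, Real.exp_neg, Real.exp_add, Real.exp_log (by positivity),
      Real.exp_log (by positivity)]
    simp
  have hinv : ∀ x, φ (cuntzAverage (efFamily 1) x) = φ x := by
    refine monomials_induction ?_ (fun x hx => ?_) (by simp) ?_ ?_
    · exact isClosed_eq (by fun_prop) (by fun_prop)
    -- The KMS condition for the pair `S_p`, `S_p* x`; summing over `p` with `∑ S_p S_p* = 1` gives
    -- invariance. Taking `x` to be a monomial makes `S_p* x` an eigenvector, hence entire.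
    · have h1 : ∀ p, φ (efFamily 1 p * (star (efFamily 1 p) * x)) =
          (Fintype.card (Fin m × Fin n) : ℂ)⁻¹ * φ (star (efFamily 1 p) * (x * efFamily 1 p)) := by
        intro p
        have hb : star (efFamily 1 p) * x ∈ monomials 1 := by
          rw [efFamily_eq]
          exact mul_mem (star_s_mem_monomials _ _) hx
        obtain ⟨l, hl⟩ := exists_isKMSEigenvector hm hn hω hb
        have h := hφ.kms _ _ _ ((isEigenvector_e p.1).mul (isEigenvector_f p.2)).isEntireOrbit
          ⟨_, hl.eigenvector.isEntireOrbit⟩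
        rw [hcard, mul_smul_comm, map_smul, smul_eq_mul, mul_assoc (star _)] at h
        exact h
      rw [cuntzAverage_apply, map_smul, map_sum, smul_eq_mul, Finset.mul_sum]
      simp only [← h1]
      rw [← map_sum]
      simp only [← mul_assoc, ← Finset.sum_mul]
      rw [hG.sum_eq_one, one_mul]
    · intro x y hx hy
      rw [map_add, map_add, map_add, hx, hy]
    · intro r x hx
      rw [map_smul, map_smul, map_smul, hx]
  ext x
  have hk : ∀ k, φ ((cuntzAverage (efFamily 1) ^ k) x) = φ x := fun k => by
    induction k with
    | zero => simp
    | succ k ih => rw [pow_succ', mul_apply_eq_comp, hinv, ih]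
  have h1 := (φ.continuous.tendsto _).comp (hω x)
  rw [Algebra.algebraMap_eq_smul_one, map_smul, hφ.map_one, smul_eq_mul, mul_one] at h1
  exact tendsto_nhds_unique (tendsto_const_nhds.congr fun k => (hk k).symm) h1

/-- The restriction of a functional to the fixed point algebra. -/
noncomputable def restrictFixedPoints {θ : Equiv.Perm (Fin m × Fin n)}
    (ω : GraphCStar θ →L[ℂ] ℂ) : fixedPoints θ →L[ℂ] ℂ :=
  ω.comp ⟨(fixedPoints θ).subtype.toAlgHom.toLinearMap, continuous_subtype_val⟩

/-- By gauge invariance the integrand over the torus is the constant `ω(x)`. -/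
theorem inducedState_restrictFixedPoints [Nontrivial (IdGraphCStar m n)]
    (hω : ∀ x, AveragesTo (efFamily 1) x (ω x)) :
    inducedState 1 (restrictFixedPoints ω) = ω := by
  ext x
  change ω (∫ p : UnitAddCircle × UnitAddCircle, gauge 1 (torus p) x) = ω x
  rw [← ω.integral_comp_comm (integrable_gauge 1 x)]
  simp only [apply_gauge hω]
  simp [MeasureTheory.Measure.real, MeasureTheory.Measure.volume_eq_prod, ← Set.univ_prod_univ]

/-- The fixed points of the gauge action are entire, with constant orbit. -/
theorem isEntireOrbit_of_mem_fixedPoints {θ : Equiv.Perm (Fin m × Fin n)} {x : GraphCStar θ}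
    (hx : x ∈ fixedPoints θ) : IsEntireOrbit (sigma θ) x fun _ => x :=
  ⟨differentiable_const x, fun _ => (hx _).symm⟩

/-- On fixed points `σ_{-i}` is the identity, so the KMS condition becomes the trace property. -/
theorem isTracialState_restrictFixedPoints {θ : Equiv.Perm (Fin m × Fin n)}
    {φ : GraphCStar θ →L[ℂ] ℂ} (hφ : IsKMSState (sigma θ) φ) :
    IsTracialState (restrictFixedPoints φ) where
  nonneg a := hφ.nonneg (a : GraphCStar θ)
  map_one := hφ.map_one
  map_mul_comm a b := hφ.kms a b _ (isEntireOrbit_of_mem_fixedPoints a.2)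
    ⟨_, isEntireOrbit_of_mem_fixedPoints b.2⟩

/-- All `s_{e_i f_j}` have the same gauge phase, so the `S_p S_q*` are fixed and both the average
and the endomorphism preserve `𝔉`; `trace_eq` then applies. -/
theorem eq_of_isTracialState [Nontrivial (IdGraphCStar m n)] (hm : m ≠ 0) (hn : n ≠ 0)
    (hω : ∀ x, AveragesTo (efFamily 1) x (ω x))
    {τ : fixedPoints (1 : Equiv.Perm (Fin m × Fin n)) →L[ℂ] ℂ} (hτ : IsTracialState τ) :
    τ = restrictFixedPoints ω := by
  have : NeZero m := ⟨hm⟩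
  have : NeZero n := ⟨hn⟩
  have hG := isCuntzFamily_ef (1 : Equiv.Perm (Fin m × Fin n))
  ext x
  refine hG.trace_eq (B := fixedPoints 1) (fun p q z => ?_) (fun x hx z => ?_) (fun x hx z => ?_) τ hτ.map_mul_comm
    hτ.map_one (hω x)
  · rw [map_mul, map_star, gauge_efFamily, gauge_efFamily, star_smul, smul_mul_smul_comm,
      mul_comm _ (star _), star_mul_self_circle, one_smul]
  · have h := hG.endomorphism_map_of_smul (star_mul_self_circle z) (gaugeHom 1 z)
      (gauge_efFamily z) x
    have hx' : gaugeHom 1 z x = x := hx z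
    rw [hx'] at h
    exact h.symm
  · have h := cuntzAverage_map_of_smul (star_mul_self_circle z) (gaugeHom 1 z)
      (gauge_efFamily z) x
    have hx' : gaugeHom 1 z x = x := hx z
    rw [hx'] at h
    exact h.symm

end IdentityGraph

end RankTwoGraph

theorem proposition4p2 (m n : ℕ) (hm : 2 ≤ m) (hn : 2 ≤ n) :
    ∃ τ : RankTwoGraph.fixedPoints (1 : Equiv.Perm (Fin m × Fin n)) →L[ℂ] ℂ,
      RankTwoGraph.IsTracialState τ ∧
      (∀ τ', RankTwoGraph.IsTracialState τ' → τ' = τ) ∧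
      RankTwoGraph.IsKMSState (RankTwoGraph.sigma 1) (RankTwoGraph.inducedState 1 τ) ∧
      ∀ φ, RankTwoGraph.IsKMSState (RankTwoGraph.sigma 1) φ →
        φ = RankTwoGraph.inducedState 1 τ := by
  have hm' : m ≠ 0 := by omega
  have hn' : n ≠ 0 := by omega
  have := RankTwoGraph.nontrivial_graphCStar hm' hn'
  obtain ⟨ω, hω⟩ := (RankTwoGraph.isCuntzFamily_ef 1).exists_limit
    (RankTwoGraph.exists_averagesTo_ef hm hn)
  have hkms := RankTwoGraph.isKMSState_limit hm' hn' hω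
  -- The state `ω` comes first and `τ` is its restriction; gauge invariance recovers `ω` as the
  -- state induced by `τ`.
  refine ⟨RankTwoGraph.restrictFixedPoints ω,
    RankTwoGraph.isTracialState_restrictFixedPoints hkms,
    fun τ' hτ' => RankTwoGraph.eq_of_isTracialState hm' hn' hω hτ', ?_⟩
  rw [RankTwoGraph.inducedState_restrictFixedPoints hω]
  exact ⟨hkms, fun φ hφ => RankTwoGraph.eq_of_isKMSState hm' hn' hω hφ⟩
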